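/- Let $\mathbb{T}$ be the infinite random recursive tree: its vertex set is $\{1,2,\dots\}$, its root is $1$, and the parent $u_j$ of each vertex $j\ge 2$ is chosen uniformly in $\{1,\dots,j-1\}$, independently of the other parents. Let $(\epsilon_j)_{j\ge 2}$ be i.i.d. standard exponential variables, independent of $\mathbb{T}$; the edge $e_j$ between $j$ and its parent $u_j$ is removed at time $\epsilon_j$. For $i\ge 1$ and $t\ge 0$ let $T_i(t)$ be the set of those vertices $j$ of the subtree of $\mathbb{T}$ rooted at $i$ (that is, $j=i$ or $j$ is a descendant of $i$) which are still connected to $i$ after all edges $e_k$ with $\epsilon_k\le t$ have been removed. Let $\Pi_1(t)$ be the set of vertices which at time $t$ are still connected to the root $1$, and let $X_1(t)=\lim_{n\to\infty} n^{-\mathrm{e}^{-t}}\#\{1\le j\le n : j\in \Pi_1(t)\}$, a limit which for every $t\ge0$ exists in $(0,\infty)$ almost surely. Then for every $i\ge 1$ and every $t\ge 0$ the limit $$\rho_i(t)=\lim_{n\to\infty} n^{-\mathrm{e}^{-t}}\,\#\{1\le j\le n : j\in T_i(t)\}$$ exists in $(0,\infty)$ almost surely. Moreover, the process $(\rho_i(t)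 : t\ge 0)$ has the same law (that is, the same finite-dimensional distributions) as $$\bigl(\beta_i^{\mathrm{e}^{-t}}X_1(t) : t\ge 0\bigr),$$ where $\beta_i$ is a beta variable with parameters $(1,i-1)$ (with $\beta_1=1$) that is independent of the process $(X_1(t):t\ge 0)$. In particular, for all $t\ge 0$ and $q\ge 0$, $$\mathbb{E}\bigl(\rho_i(t)^q\bigr)=\frac{\Gamma(q+1)\,\Gamma(i)}{\Gamma(\mathrm{e}^{-t}q+i)}<\infty .$$ -/

import Mathlib

open MeasureTheory ProbabilityTheory Filter Topology
open scoped NNReal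

namespace RecursiveTree

/-- The infinite random recursive tree and the clocks on its edges. The vertices are the integers
`1, 2, …`, rooted at `1`. The parent `u i` of each vertex `i ≥ 2` is uniform on `{1, …, i - 1}`,
independently of the other parents; the edge `e i` between `i ≥ 2` and `u i` is removed at time
`ε i`, where the `ε i` are i.i.d. standard exponential and independent of the tree.
The values `u 0, u 1, ε 0, ε 1` play no role. -/
structure IsDestruction {Ω : Type*} [MeasurableSpace Ω] (P : Measure Ω)
    (u : ℕ → Ω → ℕ) (ε : ℕ → Ω → ℝ) : Prop where
  measurable_parent : ∀ i, 2 ≤ i → Measurable (u i)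
  measurable_clock : ∀ i, 2 ≤ i → Measurable (ε i)
  law_parent : ∀ i, 2 ≤ i → HasLaw (u i) (uniformOn (Set.Icc 1 (i - 1))) P
  law_clock : ∀ i, 2 ≤ i → HasLaw (ε i) (expMeasure 1) P
  indep_parent : iIndepFun (fun i : {i : ℕ // 2 ≤ i} => u i) P
  indep_clock : iIndepFun (fun i : {i : ℕ // 2 ≤ i} => ε i) P
  indep_tree_clock : IndepFun (fun ω (i : {i : ℕ // 2 ≤ i}) => u i ω)
    (fun ω (i : {i : ℕ // 2 ≤ i}) => ε i ω) P

/-- The vertex set of the subtree rooted at `i`: the vertex `i` and all its descendants, in the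
tree where `u j` is the parent of `j`. -/
def subtree (u : ℕ → ℕ) (i : ℕ) : Set ℕ :=
  {j | Relation.ReflTransGen (fun k l => 2 ≤ l ∧ u l = k) i j}

/-- The forest which remains of the tree after the edges `e l` with `ε l ≤ t` have been removed. -/
def forest (u : ℕ → ℕ) (ε : ℕ → ℝ) (t : ℝ) : SimpleGraph ℕ :=
  SimpleGraph.fromRel (fun k l => 2 ≤ l ∧ u l = k ∧ t < ε l)

/-- The vertex set of `T_i(t)`: the vertices of the subtree rooted at `i` which are still connected
to `i` at time `t`. -/
def cluster (u : ℕ → ℕ) (ε : ℕ → ℝ) (i : ℕ) (t : ℝ) : Set ℕ :=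
  {j | j ∈ subtree u i ∧ (forest u ε t).Reachable i j}

/-- The block `Π_1(t)`: the vertices still connected to the root `1` at time `t`. -/
def rootBlock (u : ℕ → ℕ) (ε : ℕ → ℝ) (t : ℝ) : Set ℕ :=
  {j | (forest u ε t).Reachable 1 j}

/-- `n ^ (-e ^ (-t)) * #{j ≤ n : j ∈ B}`, where `j` ranges over positive integers. -/
noncomputable def scaledCount (B : Set ℕ) (t : ℝ) (n : ℕ) : ℝ :=
  (n : ℝ) ^ (-Real.exp (-t)) * ((B ∩ Set.Icc 1 n).ncard : ℝ)

/-- The weight of `B` at time `t`, the limit of the scaled counts (a fixed arbitrary number if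
there is no limit). -/
noncomputable def weight (B : Set ℕ) (t : ℝ) : ℝ :=
  limUnder atTop (scaledCount B t)

/-- The variable `ρ_i(t)`. -/
noncomputable def rho {Ω : Type*} (u : ℕ → Ω → ℕ) (ε : ℕ → Ω → ℝ) (i : ℕ) (t : ℝ) (ω : Ω) : ℝ :=
  weight (cluster (fun j => u j ω) (fun j => ε j ω) i t) t

/-- The variable `X_1(t)`, the weight of the root block. -/
noncomputable def rootWeight {Ω : Type*} (u : ℕ → Ω → ℕ) (ε : ℕ → Ω → ℝ) (t : ℝ) (ω : Ω) : ℝ :=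
  weight (rootBlock (fun j => u j ω) (fun j => ε j ω) t) t

/-- The beta distribution with parameters `(1, i - 1)`, which for `i = 1` is the unit mass
at `1`. -/
noncomputable def betaLaw (i : ℕ) : Measure ℝ :=
  if i = 1 then Measure.dirac 1 else betaMeasure 1 ((i : ℝ) - 1)

end RecursiveTree

namespace RecursiveTree

/-! Label each vertex of the subtree of i by the prescribed times at which it still belongs to the
cluster of i, and let the `profile` at n be the multiset of these labels over the vertices up to n.
Vertex n + 1 attaches to a uniform vertex. Given that it lands in the subtree of i, its parent is
uniform there, and its label is the parent's label truncated by a fresh exponential clock. Hence the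
profile of i makes the same moves as the profile of the whole tree, but only when the subtree grows:
its law at n is that of the root profile at an independent random time A_n distributed as the size
of the subtree (`IsDestruction.lintegral_profile`). Since A_n / n tends to ρ_i(0), and the root
count at time A_n is of order A_n^a X_1(t) with a = e^(-t), division by n^a gives ρ_i(0)^a X_1(t) in
the limit, jointly in finitely many t (`IsDestruction.lintegral_rho_eq`).

Existence, positivity and moments come from martingales. The number N of vertices up to n in the
cluster of i grows by one with conditional probability a N / n, and g_q(N) = Γ(N + q) / Γ(N)
satisfies g_q(N + 1) = g_q(N) (1 + q / N). So g_q(N) / g_{aq}(n) is a nonnegative martingale for q >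
-1, hence convergent. The case q = 1 gives the limit ρ_i(t), and q = -1/2 excludes the value 0. For
q ≥ 0 the limit is ρ_i(t)^q; the martingale is bounded in L², because its square is dominated by the
martingale of 2q, so the mean passes to the limit. As N = 1 at n = i, that mean is Γ(q + 1) /
g_{aq}(i).

At t = 0 the integer moments are those of the beta law (1, i - 1). This law lives on [0, 1], so they
determine it: ρ_i(0) plays the role of β_i. -/

/-- Every vertex `j ≥ 2` has its parent in `{1, …, j - 1}`. -/
def IsParentMap (u : ℕ → ℕ) : Prop := ∀ j, 2 ≤ j → u j ∈ Set.Icc 1 (j - 1)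

/-! ### Deterministic structure of subtrees and clusters -/

section Combinatorics

variable {u : ℕ → ℕ} {ε : ℕ → ℝ} {i j k : ℕ} {t : ℝ}

lemma IsParentMap.one_le (hu : IsParentMap u) (hj : 2 ≤ j) : 1 ≤ u j := (hu j hj).1

lemma IsParentMap.lt (hu : IsParentMap u) (hj : 2 ≤ j) : u j < j := by
  have := (hu j hj).2
  omega

/-- The top vertex of the component of `j` in the forest of the edges satisfying `K`. -/
def componentTop (u : ℕ → ℕ) (hu : IsParentMap u) (K : ℕ → Prop) [DecidablePred K] (j : ℕ) : ℕ :=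
  if h : 2 ≤ j ∧ K j then
    have := hu.lt h.1
    componentTop u hu K (u j)
  else j
termination_by j

lemma componentTop_of_kept (hu : IsParentMap u) (K : ℕ → Prop) [DecidablePred K]
    (h : 2 ≤ j ∧ K j) : componentTop u hu K j = componentTop u hu K (u j) := by
  rw [componentTop, dif_pos h]

lemma componentTop_of_cut (hu : IsParentMap u) (K : ℕ → Prop) [DecidablePred K]
    (h : ¬ (2 ≤ j ∧ K j)) : componentTop u hu K j = j := by
  rw [componentTop, dif_neg h]

lemma componentTop_le (hu : IsParentMap u) (K : ℕ → Prop) [DecidablePred K] (j : ℕ) :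
    componentTop u hu K j ≤ j := by
  induction j using Nat.strong_induction_on with
  | _ j ih =>
    by_cases h : 2 ≤ j ∧ K j
    · rw [componentTop_of_kept hu K h]
      exact (ih _ (hu.lt h.1)).trans (hu.lt h.1).le
    · rw [componentTop_of_cut hu K h]

lemma le_of_mem_subtree (hu : IsParentMap u) (h : j ∈ subtree u i) : i ≤ j := by
  induction h with
  | refl => exact le_rfl
  | tail _ hkl ih =>
    have := hu.lt hkl.1
    have := hkl.2
    omega

/-- Connected vertices have the same component top. If the descent from `i` to `j` crossed a removed
edge above `l`, the top of `l` would be `l` itself, while the top of `i` is at most `i < l`. This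
turns connectivity into a recursion along parents. -/
lemma cluster_eq (hu : IsParentMap u) :
    cluster u ε i t =
      {j | Relation.ReflTransGen (fun k l => 2 ≤ l ∧ u l = k ∧ t < ε l) i j} := by
  classical
  ext j
  constructor
  · rintro ⟨hj, hr⟩
    set K : ℕ → Prop := fun l => t < ε l
    have htop : ∀ v w, (forest u ε t).Reachable v w →
        componentTop u hu K w = componentTop u hu K v := by
      rintro v w ⟨p⟩
      induction p with
      | nil => rfl
      | cons hadj _ ih =>
        refine ih.trans ?_
        rw [forest, SimpleGraph.fromRel_adj] at hadj
        obtain ⟨-, ⟨h1, h2, h3⟩ | ⟨h1, h2, h3⟩⟩ := hadj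
        · rw [componentTop_of_kept hu K ⟨h1, h3⟩, h2]
        · rw [componentTop_of_kept hu K ⟨h1, h3⟩, h2]
    have key : ∀ v, v ∈ subtree u i → componentTop u hu K v = componentTop u hu K i →
        Relation.ReflTransGen (fun k l => 2 ≤ l ∧ u l = k ∧ t < ε l) i v := by
      intro v hv
      induction hv with
      | refl => exact fun _ => .refl
      | @tail k l hk hkl ih =>
        intro h
        obtain ⟨hl, rfl⟩ := hkl
        by_cases hc : t < ε l
        · rw [componentTop_of_kept hu K ⟨hl, hc⟩] at h
          exact (ih h).tail ⟨hl, rfl, hc⟩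
        · rw [componentTop_of_cut hu K (fun h' => hc h'.2)] at h
          have h1 := componentTop_le hu K i
          have h2 := le_of_mem_subtree hu hk
          have h3 := hu.lt hl
          omega
    exact key j hj (htop i j hr)
  · intro h
    change Relation.ReflTransGen _ i j at h
    refine ⟨Relation.ReflTransGen.mono (fun k l hkl => ⟨hkl.1, hkl.2.1⟩) _ _ h, ?_⟩
    induction h with
    | refl => exact SimpleGraph.Reachable.refl _
    | @tail k l _ hkl ih =>
      refine ih.trans (SimpleGraph.Adj.reachable ?_)
      rw [forest, SimpleGraph.fromRel_adj]
      have := hu.lt hkl.1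
      have := hkl.2.1
      exact ⟨by omega, .inl hkl⟩

lemma mem_subtree_self (u : ℕ → ℕ) (i : ℕ) : i ∈ subtree u i := .refl

lemma mem_cluster_self (u : ℕ → ℕ) (ε : ℕ → ℝ) (i : ℕ) (t : ℝ) : i ∈ cluster u ε i t :=
  ⟨.refl, .refl _⟩

lemma mem_subtree_iff (hi : 1 ≤ i) (hij : i < j) : j ∈ subtree u i ↔ u j ∈ subtree u i := by
  constructor
  · intro h
    rcases Relation.ReflTransGen.cases_tail h with h | ⟨k, hk, hkl⟩
    · omega
    · rw [hkl.2]
      exact hk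
  · exact fun h => Relation.ReflTransGen.tail h ⟨by omega, rfl⟩

lemma mem_cluster_iff (hu : IsParentMap u) (hi : 1 ≤ i) (hij : i < j) :
    j ∈ cluster u ε i t ↔ u j ∈ cluster u ε i t ∧ t < ε j := by
  rw [cluster_eq hu]
  constructor
  · intro h
    rcases Relation.ReflTransGen.cases_tail h with h | ⟨k, hk, hkl⟩
    · omega
    · rw [hkl.2.1]
      exact ⟨hk, hkl.2.2⟩
  · exact fun h => Relation.ReflTransGen.tail h.1 ⟨by omega, rfl, h.2⟩

lemma mem_subtree_one (hu : IsParentMap u) (hj : 1 ≤ j) : j ∈ subtree u 1 := by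
  induction j using Nat.strong_induction_on with
  | _ j ih =>
    rcases hj.eq_or_lt with rfl | h
    · exact mem_subtree_self u 1
    · exact (mem_subtree_iff le_rfl h).2 (ih _ (hu.lt h) (hu.one_le h))

lemma rootBlock_inter_Icc (hu : IsParentMap u) (n : ℕ) :
    rootBlock u ε t ∩ Set.Icc 1 n = cluster u ε 1 t ∩ Set.Icc 1 n := by
  ext j
  exact ⟨fun h => ⟨⟨mem_subtree_one hu h.2.1, h.1⟩, h.2⟩, fun h => ⟨h.1.2, h.2⟩⟩

lemma scaledCount_rootBlock (hu : IsParentMap u) :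
    scaledCount (rootBlock u ε t) t = scaledCount (cluster u ε 1 t) t := by
  ext n
  rw [scaledCount, rootBlock_inter_Icc hu, scaledCount]

/-- Seeing the subtree as the cluster at time 0 makes its asymptotic density the case t = 0 of the
results on clusters. -/
lemma cluster_zero (hu : IsParentMap u) (hε : ∀ j, 2 ≤ j → 0 < ε j) :
    cluster u ε i 0 = subtree u i := by
  rw [cluster_eq hu]
  ext j
  exact ⟨fun h => Relation.ReflTransGen.mono (fun k l hkl => ⟨hkl.1, hkl.2.1⟩) _ _ h,
    fun h => Relation.ReflTransGen.mono (fun k l hkl => ⟨hkl.1, hkl.2, hε l hkl.1⟩) _ _ h⟩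

lemma subtree_congr {u' : ℕ → ℕ} (h : ∀ j, 2 ≤ j → u j = u' j) :
    subtree u i = subtree u' i := by
  have : (fun k l => 2 ≤ l ∧ u l = k) = (fun k l => 2 ≤ l ∧ u' l = k) := by
    ext k l
    exact and_congr_right fun hl => by rw [h l hl]
  rw [subtree, this, subtree]

lemma forest_congr {u' : ℕ → ℕ} {ε' : ℕ → ℝ} (h : ∀ j, 2 ≤ j → u j = u' j ∧ ε j = ε' j) :
    forest u ε t = forest u' ε' t := by
  have : (fun k l => 2 ≤ l ∧ u l = k ∧ t < ε l) = (fun k l => 2 ≤ l ∧ u' l = k ∧ t < ε' l) := by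
    ext k l
    exact and_congr_right fun hl => by rw [(h l hl).1, (h l hl).2]
  rw [forest, this, forest]

lemma cluster_congr {u' : ℕ → ℕ} {ε' : ℕ → ℝ} (h : ∀ j, 2 ≤ j → u j = u' j ∧ ε j = ε' j) :
    cluster u ε i t = cluster u' ε' i t := by
  rw [cluster, subtree_congr fun j hj => (h j hj).1, forest_congr h, cluster]

lemma rootBlock_congr {u' : ℕ → ℕ} {ε' : ℕ → ℝ} (h : ∀ j, 2 ≤ j → u j = u' j ∧ ε j = ε' j) :
    rootBlock u ε t = rootBlock u' ε' t := by
  rw [rootBlock, forest_congr h, rootBlock]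

end Combinatorics

/-! ### Regularization on a null set -/

section Cleaning

variable {Ω : Type*} [MeasurableSpace Ω] {P : Measure Ω} {u : ℕ → Ω → ℕ} {ε : ℕ → Ω → ℝ}

lemma IsDestruction.map (h : IsDestruction P u ε) {φ : ℕ → ℕ → ℕ} {ψ : ℝ → ℝ}
    (hψ : Measurable ψ) (hφu : ∀ j, 2 ≤ j → (fun ω => φ j (u j ω)) =ᵐ[P] u j)
    (hψε : ∀ j, 2 ≤ j → (fun ω => ψ (ε j ω)) =ᵐ[P] ε j) :
    IsDestruction P (fun j ω => φ j (u j ω)) (fun j ω => ψ (ε j ω)) where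
  measurable_parent j hj :=
    (Measurable.of_discrete (f := φ j)).comp (h.measurable_parent j hj)
  measurable_clock j hj := hψ.comp (h.measurable_clock j hj)
  law_parent j hj := (h.law_parent j hj).congr (hφu j hj)
  law_clock j hj := (h.law_clock j hj).congr (hψε j hj)
  indep_parent := h.indep_parent.comp (fun j => φ j) (fun _ => Measurable.of_discrete)
  indep_clock := h.indep_clock.comp (fun _ => ψ) (fun _ => hψ)
  indep_tree_clock := by
    have h1 : Measurable fun (w : {j : ℕ // 2 ≤ j} → ℕ) (j : {j : ℕ // 2 ≤ j}) => φ j (w j) :=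
      measurable_pi_lambda _ fun j =>
        (Measurable.of_discrete (f := φ j)).comp (measurable_pi_apply j)
    have h2 : Measurable fun (w : {j : ℕ // 2 ≤ j} → ℝ) (j : {j : ℕ // 2 ≤ j}) => ψ (w j) :=
      measurable_pi_lambda _ fun j => hψ.comp (measurable_pi_apply j)
    exact h.indep_tree_clock.comp h1 h2

lemma IsDestruction.ae_parent (h : IsDestruction P u ε) {j : ℕ} (hj : 2 ≤ j) :
    ∀ᵐ ω ∂P, u j ω ∈ Set.Icc 1 (j - 1) := by
  have h0 : uniformOn (Set.Icc 1 (j - 1)) (Set.Icc 1 (j - 1))ᶜ = 0 := by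
    rw [uniformOn_eq_zero_iff (Set.finite_Icc _ _), Set.inter_compl_self]
  rw [← (h.law_parent j hj).map_eq, Measure.map_apply (h.measurable_parent j hj) (by measurability)]
    at h0
  exact h0

lemma exp_measure_Ioi (t : ℝ) (ht : 0 ≤ t) :
    expMeasure 1 (Set.Ioi t) = ENNReal.ofReal (Real.exp (-t)) := by
  have := isProbabilityMeasure_expMeasure (r := 1) one_pos
  have hc := cdf_expMeasure_eq (r := 1) one_pos t
  rw [if_pos ht, cdf_eq_real, one_mul] at hc
  rw [← Set.compl_Iic, ← ofReal_measureReal (by finiteness), probReal_compl_eq_one_sub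
    measurableSet_Iic, hc]
  congr 1
  ring

lemma IsDestruction.ae_clock_pos (h : IsDestruction P u ε) {j : ℕ} (hj : 2 ≤ j) :
    ∀ᵐ ω ∂P, 0 < ε j ω := by
  have := isProbabilityMeasure_expMeasure (r := 1) one_pos
  have h0 : expMeasure 1 (Set.Ioi 0)ᶜ = 0 := by
    rw [prob_compl_eq_zero_iff measurableSet_Ioi, exp_measure_Ioi 0 le_rfl]
    simp
  rw [← (h.law_clock j hj).map_eq, Measure.map_apply (h.measurable_clock j hj)
    measurableSet_Ioi.compl] at h0
  exact h0

/-- A destruction can be changed on a null set so that the parents form a tree and the clocks are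
positive everywhere. -/
lemma IsDestruction.exists_regular (h : IsDestruction P u ε) :
    ∃ (u' : ℕ → Ω → ℕ) (ε' : ℕ → Ω → ℝ), IsDestruction P u' ε' ∧
      (∀ ω, IsParentMap fun j => u' j ω) ∧ (∀ ω j, 2 ≤ j → 0 < ε' j ω) ∧
      ∀ᵐ ω ∂P, ∀ j, 2 ≤ j → u j ω = u' j ω ∧ ε j ω = ε' j ω := by
  classical
  -- The correction acts on each parent and each clock separately, which preserves independence. The
  -- default parent 1 is admissible for every `j ≥ 2`.
  refine ⟨_, _, h.map (φ := fun j v => if v ∈ Set.Icc 1 (j - 1) then v else 1)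
    (ψ := fun x => if 0 < x then x else 1) ?_ ?_ ?_, ?_, ?_, ?_⟩
  · exact Measurable.ite measurableSet_Ioi measurable_id measurable_const
  · intro j hj
    filter_upwards [h.ae_parent hj] with ω hω
    simp only [if_pos hω]
  · intro j hj
    filter_upwards [h.ae_clock_pos hj] with ω hω
    simp only [if_pos hω]
  · intro ω j hj
    dsimp only
    split_ifs with hc
    · exact hc
    · exact ⟨le_rfl, by omega⟩
  · intro ω j _
    split_ifs with hc
    · exact hc
    · exact one_pos
  · rw [ae_all_iff]
    intro j
    by_cases hj : 2 ≤ j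
    · filter_upwards [h.ae_parent hj, h.ae_clock_pos hj] with ω h1 h2 _
      simp only [if_pos h1, if_pos h2, and_self]
    · exact ae_of_all _ fun ω h' => absurd h' hj

end Cleaning

/-! ### Independence of the next vertex from the past -/

section History

variable {Ω : Type*} {u : ℕ → Ω → ℕ} {ε : ℕ → Ω → ℝ}

/-- The `σ`-algebra generated by the parent and the clock of the vertex `j`. -/
@[reducible] def vertexSigma (u : ℕ → Ω → ℕ) (ε : ℕ → Ω → ℝ) (j : {j : ℕ // 2 ≤ j}) :
    MeasurableSpace Ω :=
  MeasurableSpace.comap (fun ω => (u j ω, ε j ω)) inferInstance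

/-- The `σ`-algebra generated by the parents and the clocks of the vertices up to `n`. -/
@[reducible] def history (u : ℕ → Ω → ℕ) (ε : ℕ → Ω → ℝ) (n : ℕ) : MeasurableSpace Ω :=
  ⨆ j ∈ {j : {j : ℕ // 2 ≤ j} | (j : ℕ) ≤ n}, vertexSigma u ε j

lemma history_mono : Monotone (history u ε) := fun _ _ hmn =>
  biSup_mono fun _ hj => le_trans (Set.mem_ofPred.1 hj) hmn

lemma measurable_vertex {j n : ℕ} (hj : 2 ≤ j) (hjn : j ≤ n) :
    Measurable[history u ε n] (fun ω => (u j ω, ε j ω)) := by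
  have : vertexSigma u ε ⟨j, hj⟩ ≤ history u ε n :=
    le_biSup (f := fun j => vertexSigma u ε j) (s := {j : {j : ℕ // 2 ≤ j} | (j : ℕ) ≤ n}) hjn
  exact Measurable.mono (comap_measurable _) this le_rfl

variable [mΩ : MeasurableSpace Ω] {P : Measure Ω}

lemma IsDestruction.vertexSigma_le (h : IsDestruction P u ε) (j : {j : ℕ // 2 ≤ j}) :
    vertexSigma u ε j ≤ mΩ :=
  ((h.measurable_parent j j.2).prodMk (h.measurable_clock j j.2)).comap_le

lemma IsDestruction.history_le (h : IsDestruction P u ε) (n : ℕ) : history u ε n ≤ mΩ :=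
  iSup₂_le fun j _ => h.vertexSigma_le j

/-- Rectangles separate into an event on the tree and an event on the clocks; independence of the
two, then independence inside each family, factorizes everything. -/
lemma IsDestruction.measure_biInter_vertex (h : IsDestruction P u ε) [IsProbabilityMeasure P]
    (S : Finset {j : ℕ // 2 ≤ j}) {A : {j : ℕ // 2 ≤ j} → Set ℕ} {B : {j : ℕ // 2 ≤ j} → Set ℝ}
    (hB : ∀ j, MeasurableSet (B j)) :
    P (⋂ j ∈ S, (fun ω => (u j ω, ε j ω)) ⁻¹' (A j ×ˢ B j)) =
      (∏ j ∈ S, P (u j ⁻¹' A j)) * ∏ j ∈ S, P (ε j ⁻¹' B j) := by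
  have e : (⋂ j ∈ S, (fun ω => (u j ω, ε j ω)) ⁻¹' (A j ×ˢ B j)) =
      (fun ω (j : {j : ℕ // 2 ≤ j}) => u j ω) ⁻¹' (⋂ j ∈ S, (fun w => w j) ⁻¹' A j) ∩
        (fun ω (j : {j : ℕ // 2 ≤ j}) => ε j ω) ⁻¹' (⋂ j ∈ S, (fun w => w j) ⁻¹' B j) := by
    ext ω
    simp only [Set.mem_iInter, Set.mem_preimage, Set.mem_prod, Set.mem_inter_iff]
    exact ⟨fun H => ⟨fun j hj => (H j hj).1, fun j hj => (H j hj).2⟩,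
      fun H j hj => ⟨H.1 j hj, H.2 j hj⟩⟩
  rw [e, h.indep_tree_clock.measure_inter_preimage_eq_mul]
  · congr 1
    · rw [← h.indep_parent.measure_inter_preimage_eq_mul S (fun j _ => .of_discrete)]
      simp only [Set.preimage_iInter, Set.preimage_preimage]
    · rw [← h.indep_clock.measure_inter_preimage_eq_mul S (fun j _ => hB j)]
      simp only [Set.preimage_iInter, Set.preimage_preimage]
  · exact S.measurableSet_biInter fun j _ => measurable_pi_apply j .of_discrete
  · exact S.measurableSet_biInter fun j _ => measurable_pi_apply j (hB j)

lemma IsDestruction.indepFun_vertex (h : IsDestruction P u ε) [IsProbabilityMeasure P]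
    {j : ℕ} (hj : 2 ≤ j) : IndepFun (u j) (ε j) P := by
  have h1 : Measurable fun w : {j : ℕ // 2 ≤ j} → ℕ => w ⟨j, hj⟩ := measurable_pi_apply _
  have h2 : Measurable fun w : {j : ℕ // 2 ≤ j} → ℝ => w ⟨j, hj⟩ := measurable_pi_apply _
  exact h.indep_tree_clock.comp h1 h2

/-- Rectangles form a π-system generating the σ-algebra of a pair, so the product formula on
rectangles suffices. -/
lemma IsDestruction.iIndep_vertexSigma (h : IsDestruction P u ε) [IsProbabilityMeasure P] :
    iIndep (vertexSigma u ε) P := by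
  refine iIndepSets.iIndep h.vertexSigma_le
    (fun j => Set.preimage (fun ω => (u j ω, ε j ω)) ''
      (Set.image2 (· ×ˢ ·) {s | MeasurableSet s} {s | MeasurableSet s}))
    (fun j => isPiSystem_prod.comap _) (fun j => ?_) ?_
  · rw [vertexSigma, ← generateFrom_prod, MeasurableSpace.comap_generateFrom]
  · rw [iIndepSets_iff]
    intro S f hf
    have hf' : ∀ j, ∃ (A : Set ℕ) (B : Set ℝ), MeasurableSet B ∧
        (j ∈ S → f j = (fun ω => (u j ω, ε j ω)) ⁻¹' (A ×ˢ B)) := by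
      intro j
      by_cases hj : j ∈ S
      · obtain ⟨_, ⟨A, -, B, hB, rfl⟩, hAB⟩ := hf j hj
        exact ⟨A, B, hB, fun _ => hAB.symm⟩
      · exact ⟨∅, ∅, .empty, fun h => absurd h hj⟩
    choose A B hB hAB using hf'
    rw [Set.iInter₂_congr hAB, h.measure_biInter_vertex S hB, ← Finset.prod_mul_distrib]
    refine Finset.prod_congr rfl fun j hj => ?_
    rw [hAB j hj, Set.mk_preimage_prod]
    exact ((h.indepFun_vertex j.2).measure_inter_preimage_eq_mul _ _ .of_discrete (hB j)).symm

lemma IsDestruction.indepFun_history (h : IsDestruction P u ε) [IsProbabilityMeasure P]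
    {𝒳 : Type*} [MeasurableSpace 𝒳] {n : ℕ} (hn : 1 ≤ n) {Y : Ω → 𝒳}
    (hY : Measurable[history u ε n] Y) :
    IndepFun Y (fun ω => (u (n + 1) ω, ε (n + 1) ω)) P := by
  have hd : Disjoint {j : {j : ℕ // 2 ≤ j} | (j : ℕ) ≤ n} {⟨n + 1, by omega⟩} := by
    rw [Set.disjoint_singleton_right]
    simp
  have hI := indep_iSup_of_disjoint h.vertexSigma_le h.iIndep_vertexSigma hd
  rw [iSup_singleton] at hI
  exact indep_of_indep_of_le_left hI hY.comap_le

lemma lintegral_uniformOn_Icc {n : ℕ} (g : ℕ → ENNReal) :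
    ∫⁻ v, g v ∂(uniformOn (Set.Icc 1 n)) = (n : ENNReal)⁻¹ * ∑ v ∈ Finset.Icc 1 n, g v := by
  have hc : (Set.Icc 1 n : Set ℕ) = ((Finset.Icc 1 n : Finset ℕ) : Set ℕ) := by simp
  rw [uniformOn, ProbabilityTheory.cond, lintegral_smul_measure, hc, Measure.count_apply_finset,
    lintegral_finset]
  simp

/-- Conditionally on the history up to `n`, the parent of `n + 1` is uniform on `{1, …, n}` and its
clock is an independent exponential variable. -/
lemma IsDestruction.lintegral_step (h : IsDestruction P u ε) [IsProbabilityMeasure P]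
    {𝒳 : Type*} [MeasurableSpace 𝒳] {n : ℕ} (hn : 1 ≤ n) {Y : Ω → 𝒳}
    (hY : Measurable[history u ε n] Y) {Φ : 𝒳 → ℕ → ℝ → ENNReal}
    (hΦ : Measurable fun p : 𝒳 × ℕ × ℝ => Φ p.1 p.2.1 p.2.2) :
    ∫⁻ ω, Φ (Y ω) (u (n + 1) ω) (ε (n + 1) ω) ∂P =
      ∫⁻ ω, (n : ENNReal)⁻¹ * ∑ v ∈ Finset.Icc 1 n, ∫⁻ x, Φ (Y ω) v x ∂(expMeasure 1) ∂P := by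
  have := isProbabilityMeasure_expMeasure (r := 1) one_pos
  have hn2 : 2 ≤ n + 1 := by omega
  have hYm : Measurable Y := hY.mono (h.history_le n) le_rfl
  have hu := h.measurable_parent (n + 1) hn2
  have hε := h.measurable_clock (n + 1) hn2
  have : IsProbabilityMeasure (uniformOn (Set.Icc 1 n)) :=
    isProbabilityMeasure_uniformOn (Set.finite_Icc 1 n) ⟨1, by simpa using hn⟩
  have hlaw : P.map (fun ω => (Y ω, u (n + 1) ω, ε (n + 1) ω)) =
      (P.map Y).prod ((uniformOn (Set.Icc 1 n)).prod (expMeasure 1)) := by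
    have h1 := (h.law_parent (n + 1) hn2).map_eq
    rw [Nat.add_sub_cancel] at h1
    rw [(h.indepFun_history hn hY).map_prod_eq_prod_map_map hYm.aemeasurable
      (hu.prodMk hε).aemeasurable, (h.indepFun_vertex hn2).map_prod_eq_prod_map_map
      hu.aemeasurable hε.aemeasurable, h1, (h.law_clock (n + 1) hn2).map_eq]
  calc ∫⁻ ω, Φ (Y ω) (u (n + 1) ω) (ε (n + 1) ω) ∂P
      = ∫⁻ p, Φ p.1 p.2.1 p.2.2 ∂(P.map (fun ω => (Y ω, u (n + 1) ω, ε (n + 1) ω))) :=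
        (lintegral_map hΦ (hYm.prodMk (hu.prodMk hε))).symm
    _ = ∫⁻ y, ∫⁻ v, ∫⁻ x, Φ y v x ∂(expMeasure 1) ∂(uniformOn (Set.Icc 1 n)) ∂(P.map Y) := by
        rw [hlaw, lintegral_prod _ hΦ.aemeasurable]
        refine lintegral_congr fun y => ?_
        exact lintegral_prod _ (hΦ.comp measurable_prodMk_left).aemeasurable
    _ = _ := by
        rw [lintegral_map _ hYm]
        · simp only [lintegral_uniformOn_Icc]
        · refine Measurable.lintegral_prod_right' (f := fun p : 𝒳 × ℕ => ∫⁻ x, Φ p.1 p.2 x ∂_) ?_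
          refine Measurable.lintegral_prod_right'
            (f := fun p : (𝒳 × ℕ) × ℝ => Φ p.1.1 p.1.2 p.2) ?_
          exact hΦ.comp (by fun_prop : Measurable fun p : (𝒳 × ℕ) × ℝ => (p.1.1, p.1.2, p.2))

end History

/-! ### Profiles and their transition operator -/

section Profile

variable {κ : Type*}

/-- The memberships of the vertex `v` in the subtree of `i` and in the clusters of `i` at the times
`τ k`. -/
def membership (τ : κ → ℝ) (u : ℕ → ℕ) (ε : ℕ → ℝ) (i v : ℕ) : Prop × (κ → Prop) :=
  (v ∈ subtree u i, fun k => v ∈ cluster u ε i (τ k))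

open Classical in
/-- The multiset of the labels `(y v).2` of the vertices `v ≤ n` such that `(y v).1` holds. -/
noncomputable def profileOf (n : ℕ) (y : ℕ → Prop × (κ → Prop)) : Multiset (κ → Prop) :=
  ((Finset.Icc 1 n).filter fun v => (y v).1).val.map fun v => (y v).2

/-- The multiset of the memberships in the clusters of `i` at the times `τ k`, for the vertices
`v ≤ n` of the subtree of `i`. -/
noncomputable def profile (τ : κ → ℝ) (u : ℕ → ℕ) (ε : ℕ → ℝ) (i n : ℕ) : Multiset (κ → Prop) :=
  profileOf n (membership τ u ε i)

lemma profileOf_congr {n : ℕ} {y y' : ℕ → Prop × (κ → Prop)}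
    (h : ∀ v ∈ Finset.Icc 1 n, y v = y' v) : profileOf n y = profileOf n y' := by
  classical
  rw [profileOf, profileOf, Finset.filter_congr (q := fun v => (y' v).1)
    (fun v hv => by rw [h v hv])]
  exact Multiset.map_congr rfl fun v hv => by rw [h v (Finset.mem_filter.1 hv).1]

open Classical in
lemma profileOf_succ (n : ℕ) (y : ℕ → Prop × (κ → Prop)) :
    profileOf (n + 1) y =
      if (y (n + 1)).1 then (y (n + 1)).2 ::ₘ profileOf n y else profileOf n y := by
  rw [profileOf, ← Finset.insert_Icc_right_eq_Icc_add_one (by omega), Finset.filter_insert]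
  split_ifs with h
  · rw [Finset.insert_val_of_notMem (by simp), Multiset.map_cons, profileOf]
  · rw [profileOf]

lemma card_profileOf_le (n : ℕ) (y : ℕ → Prop × (κ → Prop)) :
    (profileOf n y).card ≤ n := by
  classical
  rw [profileOf, Multiset.card_map]
  exact (Finset.card_filter_le _ _).trans (by simp)

/-- The membership of a child of a vertex with membership `s`, when its clock is `x`. -/
def childMembership (τ : κ → ℝ) (s : Prop × (κ → Prop)) (x : ℝ) : Prop × (κ → Prop) :=
  (s.1, fun k => s.2 k ∧ τ k < x)

open Classical in
/-- The profile after the arrival of a child of `v` with the clock `x`. -/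
noncomputable def nextProfile (τ : κ → ℝ) (n : ℕ) (y : ℕ → Prop × (κ → Prop)) (v : ℕ) (x : ℝ) :
    Multiset (κ → Prop) :=
  if (y v).1 then (childMembership τ (y v) x).2 ::ₘ profileOf n y else profileOf n y

/-- The sum of the values of `f` after the arrival of a child of one of the vertices of a profile,
averaged over the clock of the child. -/
noncomputable def growth (τ : κ → ℝ) (f : Multiset (κ → Prop) → ENNReal)
    (M : Multiset (κ → Prop)) : ENNReal :=
  (M.map fun S => ∫⁻ x, f ((fun k => S k ∧ τ k < x) ::ₘ M) ∂(expMeasure 1)).sum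

/-- The transition operator of the profiles at time `n`. -/
noncomputable def transition (τ : κ → ℝ) (n : ℕ) (f : Multiset (κ → Prop) → ENNReal)
    (M : Multiset (κ → Prop)) : ENNReal :=
  (n : ENNReal)⁻¹ * (((n - M.card : ℕ) : ENNReal) * f M + growth τ f M)

/-- A parent outside the subtree leaves the profile unchanged, and there are `n - card` of these; a
parent inside adds its truncated label. The result depends on the memberships only through the
profile, which is what makes the profile a Markov chain. -/
lemma sum_lintegral_nextProfile (τ : κ → ℝ) (n : ℕ) (y : ℕ → Prop × (κ → Prop))
    (f : Multiset (κ → Prop) → ENNReal) :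
    ∑ v ∈ Finset.Icc 1 n, ∫⁻ x, f (nextProfile τ n y v x) ∂(expMeasure 1) =
      ((n - (profileOf n y).card : ℕ) : ENNReal) * f (profileOf n y) +
        growth τ f (profileOf n y) := by
  classical
  have := isProbabilityMeasure_expMeasure (r := 1) one_pos
  rw [← Finset.sum_filter_not_add_sum_filter (Finset.Icc 1 n) fun v => (y v).1]
  congr 1
  · have hc : ((Finset.Icc 1 n).filter fun v => ¬ (y v).1).card = n - (profileOf n y).card := by
      have := Finset.card_filter_add_card_filter_not (s := Finset.Icc 1 n) (fun v => (y v).1)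
      rw [profileOf, Multiset.card_map, Finset.card_val]
      simp only [Nat.card_Icc] at this
      omega
    rw [← hc, ← nsmul_eq_mul, ← Finset.sum_const]
    refine Finset.sum_congr rfl fun v hv => ?_
    simp only [nextProfile, if_neg (Finset.mem_filter.1 hv).2, lintegral_const, measure_univ,
      mul_one]
  · rw [growth]
    conv_rhs => enter [1, 2]; rw [profileOf]
    rw [Multiset.map_map]
    refine Finset.sum_congr rfl fun v hv => ?_
    simp only [nextProfile, if_pos (Finset.mem_filter.1 hv).2, childMembership, Function.comp]

variable {u : ℕ → ℕ} {ε : ℕ → ℝ} {i n : ℕ} {τ : κ → ℝ}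

lemma membership_of_lt (hu : IsParentMap u) {v : ℕ} (hv : v < i) :
    membership τ u ε i v = (False, fun _ => False) := by
  have hn : v ∉ subtree u i := fun h => absurd (le_of_mem_subtree hu h) (by omega)
  have hn' : ∀ t, v ∉ cluster u ε i t := fun t h => hn h.1
  simp only [membership, hn, hn']

lemma membership_self : membership τ u ε i i = (True, fun _ => True) := by
  simp only [membership, mem_subtree_self, mem_cluster_self]

lemma membership_of_gt (hu : IsParentMap u) (hi : 1 ≤ i) {v : ℕ} (hv : i < v) :
    membership τ u ε i v = childMembership τ (membership τ u ε i (u v)) (ε v) := by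
  simp only [membership, childMembership, mem_subtree_iff hi hv, mem_cluster_iff hu hi hv]

lemma profile_succ (hu : IsParentMap u) (hi : 1 ≤ i) (hin : i ≤ n) :
    profile τ u ε i (n + 1) =
      nextProfile τ n (membership τ u ε i) (u (n + 1)) (ε (n + 1)) := by
  classical
  rw [profile, profileOf_succ, membership_of_gt hu hi (by omega), nextProfile]
  rfl

lemma profile_of_lt (hu : IsParentMap u) (hn : n < i) : profile τ u ε i n = 0 := by
  classical
  rw [profile, profileOf, Finset.filter_false_of_mem]
  · rfl
  · intro v hv
    rw [membership_of_lt hu (lt_of_le_of_lt (Finset.mem_Icc.1 hv).2 hn)]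
    exact not_false

lemma profile_self (hu : IsParentMap u) (hi : 1 ≤ i) :
    profile τ u ε i i = {fun _ => True} := by
  classical
  obtain ⟨m, rfl⟩ : ∃ m, i = m + 1 := ⟨i - 1, by omega⟩
  rw [profile, profileOf_succ, ← profile, profile_of_lt hu (by omega), membership_self]
  simp

open Classical in
lemma card_profile :
    (profile τ u ε i n).card = ((Finset.Icc 1 n).filter (· ∈ subtree u i)).card := by
  rw [profile, profileOf, Multiset.card_map]
  rfl

lemma card_profile_le : (profile τ u ε i n).card ≤ n := card_profileOf_le _ _

lemma card_profile_one (hu : IsParentMap u) : (profile τ u ε 1 n).card = n := by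
  classical
  rw [card_profile, Finset.filter_true_of_mem, Nat.card_Icc, Nat.add_sub_cancel]
  exact fun v hv => mem_subtree_one hu (Finset.mem_Icc.1 hv).1

open Classical in
lemma countP_profile (k : κ) :
    ((profile τ u ε i n).countP fun S => S k) =
      (cluster u ε i (τ k) ∩ Set.Icc 1 n).ncard := by
  have h : (cluster u ε i (τ k) ∩ Set.Icc 1 n) = (((Finset.Icc 1 n).filter (· ∈ subtree u i)).filter
      (· ∈ cluster u ε i (τ k)) : Finset ℕ) := by
    ext v
    simp only [Finset.coe_filter, Finset.mem_filter, Finset.mem_Icc, Set.mem_inter_iff,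
      Set.mem_Icc, Set.mem_ofPred_eq]
    exact ⟨fun h => ⟨⟨h.2, h.1.1⟩, h.1⟩, fun h => ⟨h.2, h.1.1⟩⟩
  rw [h, Set.ncard_coe_finset, profile, profileOf, Multiset.countP_map]
  rfl

end Profile

/-! ### Markov property of the profile and comparison with the root -/

section Measurability

variable {Ω : Type*} {κ : Type*} {u : ℕ → Ω → ℕ} {ε : ℕ → Ω → ℝ} {i n : ℕ} {τ : κ → ℝ}

/-- The extension by a constant of a family indexed by `{0, …, n}`. -/
def extendFamily {α : Type*} (a : α) (y : Fin (n + 1) → α) (v : ℕ) : α :=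
  if h : v < n + 1 then y ⟨v, h⟩ else a

lemma extendFamily_of_le {α : Type*} (a : α) (y : ℕ → α) {v : ℕ} (hv : v ≤ n) :
    extendFamily (n := n) a (fun w => y w) v = y v := by
  rw [extendFamily, dif_pos (by omega)]

lemma measurable_childMembership_snd (S : κ → Prop) :
    Measurable fun x => (fun k => S k ∧ τ k < x : κ → Prop) := by
  refine measurable_pi_lambda _ fun k => ?_
  refine measurable_to_prop ?_
  have : (fun x => S k ∧ τ k < x) ⁻¹' {True} = {x | S k ∧ τ k < x} := by
    ext x
    simp
  rw [this]
  by_cases hS : S k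
  · simp only [hS, true_and]
    exact measurableSet_Ioi
  · simp [hS]

lemma measurable_childMembership (s : Prop × (κ → Prop)) : Measurable (childMembership τ s) :=
  measurable_const.prodMk (measurable_childMembership_snd s.2)

variable [Fintype κ]

lemma measurable_membership (hu : ∀ ω, IsParentMap fun j => u j ω) (hi : 1 ≤ i) (n : ℕ) :
    Measurable[history u ε n] fun ω (v : Fin (n + 1)) =>
      membership τ (fun j => u j ω) (fun j => ε j ω) i v := by
  induction n with
  | zero =>
    have : (fun ω (v : Fin (0 + 1)) => membership τ (fun j => u j ω) (fun j => ε j ω) i v) =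
        fun _ _ => (False, fun _ => False) := by
      ext1 ω
      ext1 v
      exact membership_of_lt (hu ω) (by omega)
    rw [this]
    exact measurable_const
  | succ n ih =>
    refine @measurable_pi_lambda _ _ _ (history u ε (n + 1)) _ _ fun v => ?_
    have ih' := ih.mono (history_mono (Nat.le_succ n)) le_rfl
    by_cases hv : (v : ℕ) ≤ n
    · exact (measurable_pi_apply (⟨v, by omega⟩ : Fin (n + 1))).comp ih'
    · have hv' : (v : ℕ) = n + 1 := by omega
      rw [hv']
      rcases lt_trichotomy (n + 1) i with hlt | heq | hgt
      · simp only [fun ω => membership_of_lt (τ := τ) (ε := fun j => ε j ω) (hu ω) hlt]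
        exact measurable_const
      · rw [heq]
        simp only [membership_self]
        exact measurable_const
      · simp only [fun ω => membership_of_gt (τ := τ) (ε := fun j => ε j ω) (hu ω) hi hgt]
        have hpair := measurable_vertex (u := u) (ε := ε) (j := n + 1) (by omega) le_rfl
        -- The past memberships and the parent range over a countable discrete space, so
        -- measurability in the clock alone is enough.
        have hg : Measurable fun p : ((Fin (n + 1) → Prop × (κ → Prop)) × ℕ) × ℝ =>
            childMembership τ (extendFamily (False, fun _ => False) p.1.1 p.1.2) p.2 :=
          measurable_from_prod_countable_right fun p =>
            measurable_childMembership (extendFamily (False, fun _ => False) p.1 p.2)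
        have hcomp := hg.comp
          ((ih'.prodMk (measurable_fst.comp hpair)).prodMk (measurable_snd.comp hpair))
        convert hcomp using 2 with ω
        have := (hu ω).lt (j := n + 1) (by omega)
        simp only [Function.comp]
        rw [extendFamily_of_le _ (membership τ (fun j => u j ω) (fun j => ε j ω) i) (by omega)]

lemma measurable_profile (hu : ∀ ω, IsParentMap fun j => u j ω) (hi : 1 ≤ i) (n : ℕ)
    {β : Type*} [MeasurableSpace β] (f : Multiset (κ → Prop) → β) :
    Measurable[history u ε n] fun ω =>
      f (profile τ (fun j => u j ω) (fun j => ε j ω) i n) := by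
  have h := (Measurable.of_discrete (f := fun y : Fin (n + 1) → Prop × (κ → Prop) =>
    f (profileOf n (extendFamily (False, fun _ => False) y)))).comp
      (measurable_membership (τ := τ) (ε := ε) hu hi n)
  convert h using 2 with ω
  simp only [Function.comp, profile]
  rw [profileOf_congr fun v hv => ?_]
  rw [extendFamily_of_le _ (membership τ (fun j => u j ω) (fun j => ε j ω) i)
    (Finset.mem_Icc.1 hv).2]

variable [mΩ : MeasurableSpace Ω] {P : Measure Ω} [IsProbabilityMeasure P]

/-- Markov property in weak form: the arbitrary weight `W`, measurable with respect to the past,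
stands in for conditioning on the history. -/
lemma IsDestruction.lintegral_profile_succ (h : IsDestruction P u ε)
    (hu : ∀ ω, IsParentMap fun j => u j ω) (hi : 1 ≤ i) (hin : i ≤ n)
    {W : Ω → ENNReal} (hW : Measurable[history u ε n] W) (f : Multiset (κ → Prop) → ENNReal) :
    ∫⁻ ω, W ω * f (profile τ (fun j => u j ω) (fun j => ε j ω) i (n + 1)) ∂P =
      ∫⁻ ω, W ω * transition τ n f (profile τ (fun j => u j ω) (fun j => ε j ω) i n) ∂P := by
  set a : Prop × (κ → Prop) := (False, fun _ => False)
  have hY := hW.prodMk (measurable_membership (τ := τ) (ε := ε) hu hi n)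
  have hext : ∀ ω, profileOf n (extendFamily (n := n) a fun v =>
      membership τ (fun j => u j ω) (fun j => ε j ω) i v) =
        profile τ (fun j => u j ω) (fun j => ε j ω) i n := fun ω =>
    profileOf_congr fun v hv => extendFamily_of_le a
      (membership τ (fun j => u j ω) (fun j => ε j ω) i) (Finset.mem_Icc.1 hv).2
  have hmeas : ∀ (y : Fin (n + 1) → Prop × (κ → Prop)) (v : ℕ),
      Measurable fun x => f (nextProfile τ n (extendFamily a y) v x) := by
    intro y v
    by_cases hy : (extendFamily a y v).1
    · simp only [nextProfile, if_pos hy]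
      exact (Measurable.of_discrete (f := fun S => f (S ::ₘ profileOf n (extendFamily a y)))).comp
        (measurable_childMembership_snd _)
    · simp only [nextProfile, if_neg hy]
      exact measurable_const
  have hΦ : Measurable fun p : (ENNReal × (Fin (n + 1) → Prop × (κ → Prop))) × ℕ × ℝ =>
      p.1.1 * f (nextProfile τ n (extendFamily a p.1.2) p.2.1 p.2.2) := by
    have h1 : Measurable fun p : ((Fin (n + 1) → Prop × (κ → Prop)) × ℕ) × ℝ =>
        f (nextProfile τ n (extendFamily a p.1.1) p.1.2 p.2) :=
      measurable_from_prod_countable_right fun p => hmeas p.1 p.2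
    have h2 : Measurable fun p : (ENNReal × (Fin (n + 1) → Prop × (κ → Prop))) × ℕ × ℝ =>
        ((p.1.2, p.2.1), p.2.2) := by fun_prop
    exact (measurable_fst.comp measurable_fst).mul (h1.comp h2)
  have key := h.lintegral_step (hi.trans hin) hY
    (Φ := fun y v x => y.1 * f (nextProfile τ n (extendFamily a y.2) v x)) hΦ
  refine Eq.trans (lintegral_congr fun ω => ?_) (key.trans (lintegral_congr fun ω => ?_))
  · dsimp only
    have hlt := (hu ω).lt (j := n + 1) (by omega)
    rw [profile_succ (hu ω) hi hin, nextProfile, nextProfile, hext,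
      extendFamily_of_le a (membership τ (fun j => u j ω) (fun j => ε j ω) i) (by omega)]
    rfl
  · dsimp only
    simp only [lintegral_const_mul _ (hmeas _ _)]
    rw [← Finset.mul_sum, sum_lintegral_nextProfile, hext, transition]
    ring

/-- The profile of the subtree of `i` is distributed as the profile of the whole tree, stopped at
an independent time with the law of the size of the subtree. -/
lemma IsDestruction.lintegral_profile (h : IsDestruction P u ε)
    (hu : ∀ ω, IsParentMap fun j => u j ω) (hi : 1 ≤ i) (hin : i ≤ n)
    (f : Multiset (κ → Prop) → ENNReal) :
    ∫⁻ ω, f (profile τ (fun j => u j ω) (fun j => ε j ω) i n) ∂P =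
      ∫⁻ ω, ∫⁻ ω', f (profile τ (fun j => u j ω') (fun j => ε j ω') 1
        (profile τ (fun j => u j ω) (fun j => ε j ω) i n).card) ∂P ∂P := by
  induction n, hin using Nat.le_induction generalizing f with
  | base => simp [profile_self (hu _) hi, profile_self (hu _) le_rfl]
  | succ n hin ih =>
    have hstep : ∀ g : Multiset (κ → Prop) → ENNReal,
        ∫⁻ ω, g (profile τ (fun j => u j ω) (fun j => ε j ω) i (n + 1)) ∂P =
          ∫⁻ ω, transition τ n g (profile τ (fun j => u j ω) (fun j => ε j ω) i n) ∂P := by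
      intro g
      simpa only [one_mul] using
        h.lintegral_profile_succ (τ := τ) hu hi hin (W := fun _ => 1) measurable_const g
    -- The subtree of the root misses no vertex, so the idle term of the transition vanishes and
    -- each step is pure growth.
    have hroot : ∀ a : ℕ, ∫⁻ ω, growth τ f (profile τ (fun j => u j ω) (fun j => ε j ω) 1 a) ∂P =
        a * ∫⁻ ω, f (profile τ (fun j => u j ω) (fun j => ε j ω) 1 (a + 1)) ∂P := by
      intro a
      rcases Nat.eq_zero_or_pos a with rfl | ha
      · simp [profile_of_lt (hu _) one_pos, growth]
      · have h1 := h.lintegral_profile_succ (τ := τ) hu le_rfl (n := a) ha (W := fun _ => 1)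
          measurable_const f
        simp only [one_mul, transition, card_profile_one (hu _), Nat.sub_self, Nat.cast_zero,
          zero_mul, zero_add] at h1
        rw [lintegral_const_mul' _ _ (by simp; omega)] at h1
        rw [h1, ← mul_assoc, ENNReal.mul_inv_cancel (by simp; omega) (by simp), one_mul]
    rw [hstep f, ih (transition τ n f)]
    set H : ℕ → ENNReal := fun a =>
      ∫⁻ ω', f (profile τ (fun j => u j ω') (fun j => ε j ω') 1 a) ∂P with hH
    -- Intertwining: averaging the transition of `f` over a root profile of size `M.card` gives the
    -- transition of `H ∘ card` at `M`. The size chain with kernel `H` therefore reproduces the step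
    -- of the profile.
    have h2 := hstep fun M => H M.card
    refine Eq.trans ?_ h2.symm
    refine lintegral_congr fun ω => ?_
    generalize profile τ (fun j => u j ω) (fun j => ε j ω) i n = M
    have := isProbabilityMeasure_expMeasure (r := 1) one_pos
    simp only [transition, card_profile_one (hu _)]
    rw [lintegral_const_mul' _ _ (by simp; omega), lintegral_add_left, lintegral_const_mul', hroot]
    · simp [growth, hH]
    · simp
    · exact (measurable_profile (ε := ε) hu le_rfl M.card fun N => _ * f N).mono (h.history_le _)
        le_rfl

end Measurability

/-! ### Asymptotics of Gamma ratios -/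

section GammaRatio

variable {q : ℝ} {n : ℕ}

/-- The ratio `Γ(n + q) / Γ(n)`, which is equivalent to `n ^ q`. -/
noncomputable def gammaRatio (q : ℝ) (n : ℕ) : ℝ := Real.Gamma (n + q) / Real.Gamma n

lemma gammaRatio_pos (hq : -1 < q) (hn : 1 ≤ n) : 0 < gammaRatio q n := by
  have : (1 : ℝ) ≤ n := by exact_mod_cast hn
  exact div_pos (Real.Gamma_pos_of_pos (by linarith)) (Real.Gamma_pos_of_pos (by linarith))

lemma gammaRatio_nonneg (hq : -1 < q) (n : ℕ) : 0 ≤ gammaRatio q n := by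
  rcases Nat.eq_zero_or_pos n with rfl | hn
  · simp [gammaRatio, Real.Gamma_zero]
  · exact (gammaRatio_pos hq hn).le

lemma gammaRatio_succ (hq : -1 < q) (hn : 1 ≤ n) :
    gammaRatio q (n + 1) = gammaRatio q n * (1 + q / n) := by
  have hn' : (1 : ℝ) ≤ n := by exact_mod_cast hn
  have hG : Real.Gamma n ≠ 0 := (Real.Gamma_pos_of_pos (by linarith)).ne'
  rw [gammaRatio, gammaRatio, Nat.cast_add_one, Real.Gamma_add_one (by linarith),
    add_right_comm, Real.Gamma_add_one (by linarith)]
  field_simp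

lemma gammaRatio_one_right (q : ℝ) : gammaRatio q 1 = Real.Gamma (q + 1) := by
  simp [gammaRatio, add_comm]

lemma gammaRatio_one_left (n : ℕ) : gammaRatio 1 n = n := by
  rcases Nat.eq_zero_or_pos n with rfl | hn
  · simp [gammaRatio, Real.Gamma_zero]
  · have hn' : (0 : ℝ) < n := by exact_mod_cast hn
    rw [gammaRatio, Real.Gamma_add_one hn'.ne', mul_div_assoc,
      div_self (Real.Gamma_pos_of_pos hn').ne', mul_one]

lemma prod_add_mul_Gamma (hq : ∀ m : ℕ, q ≠ -m) (n : ℕ) :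
    (∏ j ∈ Finset.range n, (q + j)) * Real.Gamma q = Real.Gamma (n + q) := by
  induction n with
  | zero => simp
  | succ n ih =>
    have hne : (n : ℝ) + q ≠ 0 := fun h => hq n (by linarith)
    rw [Finset.prod_range_succ, Nat.cast_add_one, add_right_comm, Real.Gamma_add_one hne, ← ih]
    ring

/-- This is Euler's limit formula for Γ(q). Its product has one factor more than Γ(n + q) / Γ(q),
whence the correction n / (n + q). -/
lemma tendsto_gammaRatio_div (hq : -1 < q) :
    Tendsto (fun n : ℕ => gammaRatio q n / (n : ℝ) ^ q) atTop (𝓝 1) := by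
  -- Euler's formula cannot be used at the pole q = 0, where the ratio is identically 1.
  rcases eq_or_ne q 0 with rfl | hq0
  · refine tendsto_const_nhds.congr' ?_
    filter_upwards [eventually_ge_atTop 1] with n hn
    have hn' : (0 : ℝ) < n := by exact_mod_cast hn
    rw [gammaRatio, add_zero, div_self (Real.Gamma_pos_of_pos hn').ne', Real.rpow_zero, div_one]
  · have hq' : ∀ m : ℕ, q ≠ -m := by
      intro m hm
      rcases Nat.eq_zero_or_pos m with rfl | h
      · exact hq0 (by simpa using hm)
      · have : (1 : ℝ) ≤ m := by exact_mod_cast h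
        linarith
    have hG : Real.Gamma q ≠ 0 := Real.Gamma_ne_zero hq'
    have h1 : Tendsto (fun n : ℕ => Real.Gamma q / Real.GammaSeq q n * ((n : ℝ) / (n + q)))
        atTop (𝓝 (Real.Gamma q / Real.Gamma q * 1)) :=
      (tendsto_const_nhds.div (Real.GammaSeq_tendsto_Gamma q) hG).mul
        (tendsto_natCast_div_add_atTop q)
    rw [div_self hG, one_mul] at h1
    refine h1.congr' ?_
    filter_upwards [eventually_ge_atTop 1] with n hn
    have hn' : (1 : ℝ) ≤ n := by exact_mod_cast hn
    have hP := prod_add_mul_Gamma hq' (n + 1)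
    rw [Nat.cast_add_one, add_right_comm, Real.Gamma_add_one (by linarith)] at hP
    have hP0 : (∏ j ∈ Finset.range (n + 1), (q + j)) ≠ 0 :=
      Finset.prod_ne_zero_iff.2 fun j _ h => hq' j (by linarith)
    have hfac : (n.factorial : ℝ) = n * Real.Gamma n := by
      rw [← Real.Gamma_add_one (by linarith), Real.Gamma_nat_eq_factorial]
    have hGn : Real.Gamma n ≠ 0 := (Real.Gamma_pos_of_pos (by linarith)).ne'
    have hpow : (n : ℝ) ^ q ≠ 0 := (Real.rpow_pos_of_pos (by linarith) q).ne'
    have hnq : (n : ℝ) + q ≠ 0 := by linarith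
    rw [Real.GammaSeq, gammaRatio, hfac]
    field_simp
    linarith

lemma exists_gammaRatio_bounds (hq : -1 < q) :
    ∃ c C : ℝ, 0 < c ∧ 0 < C ∧ ∀ n : ℕ, 1 ≤ n →
      c * (n : ℝ) ^ q ≤ gammaRatio q n ∧ gammaRatio q n ≤ C * (n : ℝ) ^ q := by
  have hpos : ∀ n : ℕ, 1 ≤ n → 0 < gammaRatio q n / (n : ℝ) ^ q := fun n hn =>
    div_pos (gammaRatio_pos hq hn) (Real.rpow_pos_of_pos (by exact_mod_cast hn) q)
  have bound : ∀ f : ℕ → ℝ, Tendsto f atTop (𝓝 1) →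
      ∃ C : ℝ, 0 < C ∧ ∀ n, f n ≤ C := by
    intro f hf
    obtain ⟨C, hC⟩ := hf.bddAbove_range
    exact ⟨max C 1, by positivity, fun n => (hC ⟨n, rfl⟩).trans (le_max_left _ _)⟩
  obtain ⟨C, hC0, hC⟩ := bound _ (tendsto_gammaRatio_div hq)
  have hinv := (tendsto_gammaRatio_div hq).inv₀ one_ne_zero
  rw [inv_one] at hinv
  obtain ⟨D, hD0, hD⟩ := bound _ hinv
  refine ⟨D⁻¹, C, by positivity, hC0, fun n hn => ?_⟩
  have hn' : 0 < (n : ℝ) ^ q := Real.rpow_pos_of_pos (by exact_mod_cast hn) q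
  constructor
  · rw [← le_div_iff₀ hn']
    exact inv_le_of_inv_le₀ (hpos n hn) (hD n)
  · rw [← div_le_iff₀ hn']
    exact hC n

end GammaRatio

/-! ### Gamma ratios as eigenfunctions of the transition -/

section Transition

lemma sum_map_ite {α : Type*} (M : Multiset α) (p : α → Prop) [DecidablePred p] (A B : ENNReal) :
    (M.map fun S => if p S then A else B).sum =
      M.countP p * A + ((M.card - M.countP p : ℕ) : ENNReal) * B := by
  induction M using Multiset.induction_on with
  | empty => simp
  | cons S M ih =>
    have := Multiset.countP_le_card p M
    rw [Multiset.map_cons, Multiset.sum_cons, ih, Multiset.countP_cons, Multiset.card_cons]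
    split_ifs with h
    · rw [Nat.add_sub_add_right]
      push_cast
      ring
    · rw [add_zero, Nat.sub_add_comm this]
      push_cast
      ring

lemma lintegral_exp_ite {t : ℝ} (ht : 0 ≤ t) (A B : ENNReal) :
    ∫⁻ x, (if t < x then A else B) ∂(expMeasure 1) =
      ENNReal.ofReal (Real.exp (-t)) * A + ENNReal.ofReal (1 - Real.exp (-t)) * B := by
  have := isProbabilityMeasure_expMeasure (r := 1) one_pos
  have h1 : (fun x => if t < x then A else B) =
      fun x => (Set.Ioi t).indicator (fun _ => A) x + (Set.Ioi t)ᶜ.indicator (fun _ => B) x := by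
    ext x
    by_cases h : t < x
    · simp [h]
    · simp [h, not_lt.1 h]
  rw [h1, lintegral_add_left (measurable_const.indicator measurableSet_Ioi),
    lintegral_indicator_const measurableSet_Ioi, lintegral_indicator_const measurableSet_Ioi.compl,
    prob_compl_eq_one_sub measurableSet_Ioi, exp_measure_Ioi t ht,
    ENNReal.ofReal_sub _ (Real.exp_nonneg _), ENNReal.ofReal_one, mul_comm, mul_comm B]

-- The count N increases with probability e^(-t) N / n, and an increase multiplies the Gamma ratio
-- by 1 + q / N. The factor N cancels, leaving a mean multiplier that does not depend on the
-- profile.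
open Classical in
lemma transition_gammaRatio {q t : ℝ} (hq : -1 < q) (ht : 0 ≤ t) {n : ℕ} (hn : 1 ≤ n)
    {M : Multiset (Unit → Prop)} (hM : M.card ≤ n) (hN : 1 ≤ M.countP fun S => S ()) :
    transition (fun _ => t) n
      (fun M => ENNReal.ofReal (gammaRatio q (M.countP fun S => S ()))) M =
      ENNReal.ofReal (1 + Real.exp (-t) * q / n) *
        ENNReal.ofReal (gammaRatio q (M.countP fun S => S ())) := by
  have := isProbabilityMeasure_expMeasure (r := 1) one_pos
  set a := Real.exp (-t) with ha
  have ha0 : 0 ≤ a := Real.exp_nonneg _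
  have ha1 : a ≤ 1 := Real.exp_le_one_iff.2 (by linarith)
  have hle := Multiset.countP_le_card (fun S : Unit → Prop => S ()) M
  set N := M.countP fun S => S () with hNdef
  have hg := gammaRatio_pos hq hN
  have hg' := gammaRatio_nonneg hq (N + 1)
  have hgrowth : growth (fun _ => t)
      (fun M => ENNReal.ofReal (gammaRatio q (M.countP fun S => S ()))) M =
      ENNReal.ofReal (N * (a * gammaRatio q (N + 1) + (1 - a) * gammaRatio q N) +
        (M.card - N) * gammaRatio q N) := by
    have hterm : ∀ S : Unit → Prop, ∫⁻ x, ENNReal.ofReal (gammaRatio q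
        (((fun k => S k ∧ t < x : Unit → Prop) ::ₘ M).countP fun S => S ())) ∂(expMeasure 1) =
        if S () then ENNReal.ofReal (a * gammaRatio q (N + 1) + (1 - a) * gammaRatio q N)
          else ENNReal.ofReal (gammaRatio q N) := by
      intro S
      split_ifs with hS
      · rw [ENNReal.ofReal_add (by positivity) (mul_nonneg (by linarith) hg.le),
          ENNReal.ofReal_mul ha0, ENNReal.ofReal_mul (by linarith), ← lintegral_exp_ite ht]
        refine lintegral_congr fun x => ?_
        rw [Multiset.countP_cons]
        by_cases hx : t < x <;> simp [hS, hx, hNdef]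
      · simp [hS, hNdef]
    rw [growth, Multiset.map_congr rfl fun S _ => hterm S, sum_map_ite, ← hNdef,
      ← ENNReal.ofReal_natCast, ← ENNReal.ofReal_natCast, Nat.cast_sub hle,
      ← ENNReal.ofReal_mul (by positivity), ← ENNReal.ofReal_mul (by simpa using hle),
      ENNReal.ofReal_add]
    · exact mul_nonneg (by positivity)
        (add_nonneg (by positivity) (mul_nonneg (by linarith) hg.le))
    · exact mul_nonneg (by simpa using hle) hg.le
  have hn' : (0 : ℝ) < n := by exact_mod_cast hn
  have hN' : (0 : ℝ) < N := by exact_mod_cast hN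
  have hM' : (0 : ℝ) ≤ n - M.card := by simpa using hM
  have hle' : (0 : ℝ) ≤ M.card - N := by simpa using hle
  have h1a : 0 ≤ 1 - a := by linarith
  rw [transition, hgrowth, ← hNdef, ← ENNReal.ofReal_natCast (n - M.card), Nat.cast_sub hM,
    ← ENNReal.ofReal_natCast n, ← ENNReal.ofReal_inv_of_pos hn', ← ENNReal.ofReal_mul hM',
    ← ENNReal.ofReal_add (by positivity) (by positivity), ← ENNReal.ofReal_mul (by positivity),
    ← ENNReal.ofReal_mul' hg.le]
  congr 1
  rw [gammaRatio_succ hq hN]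
  field_simp
  ring

end Transition

/-! ### Passing to the limit in expectations under an L² bound -/

lemma uniformIntegrable_of_sq_le {Ω : Type*} [MeasurableSpace Ω] {P : Measure Ω}
    [IsProbabilityMeasure P] {f : ℕ → Ω → ℝ} (hf : ∀ n, AEStronglyMeasurable (f n) P) {K : ℝ}
    (hK : ∀ n, ∫⁻ ω, ENNReal.ofReal (f n ω ^ 2) ∂P ≤ ENNReal.ofReal K) :
    UniformIntegrable f 1 P := by
  refine uniformIntegrable_of le_rfl ENNReal.one_ne_top hf fun δ hδ => ?_
  -- Above a threshold C one has |f| ≤ f² / C, so C must make K / C ≤ δ; the added 1 keeps C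
  -- positive when K = 0.
  have hC : 0 < |K| / δ + 1 := by positivity
  refine ⟨⟨|K| / δ + 1, hC.le⟩, fun n => ?_⟩
  rw [eLpNorm_one_eq_lintegral_enorm]
  calc ∫⁻ ω, ‖Set.indicator {x | (⟨|K| / δ + 1, hC.le⟩ : ℝ≥0) ≤ ‖f n x‖₊} (f n) ω‖ₑ ∂P
      ≤ ∫⁻ ω, ENNReal.ofReal (|K| / δ + 1)⁻¹ * ENNReal.ofReal (f n ω ^ 2) ∂P := by
        refine lintegral_mono fun ω => ?_
        rw [← ENNReal.ofReal_mul (by positivity), Set.indicator_apply]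
        split_ifs with h
        · rw [← ofReal_norm]
          refine ENNReal.ofReal_le_ofReal ?_
          have h' : |K| / δ + 1 ≤ |f n ω| := h
          rw [Real.norm_eq_abs, ← sq_abs (f n ω), inv_mul_eq_div, le_div_iff₀ hC, sq]
          exact mul_le_mul_of_nonneg_left h' (abs_nonneg _)
        · simp
    _ ≤ ENNReal.ofReal (|K| / δ + 1)⁻¹ * ENNReal.ofReal K := by
        rw [lintegral_const_mul' _ _ ENNReal.ofReal_ne_top]
        gcongr
        exact hK n
    _ ≤ ENNReal.ofReal δ := by
        rw [← ENNReal.ofReal_mul (by positivity)]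
        refine ENNReal.ofReal_le_ofReal ?_
        rw [inv_mul_eq_div, div_le_iff₀ hC, mul_add, mul_div_cancel₀ _ hδ.ne']
        have := le_abs_self K
        linarith

/-- Vitali's theorem: uniform integrability upgrades almost sure convergence to convergence in L¹.
-/
lemma integral_of_tendsto_of_sq_le {Ω : Type*} [MeasurableSpace Ω] {P : Measure Ω}
    [IsProbabilityMeasure P] {f : ℕ → Ω → ℝ} {g : Ω → ℝ}
    (hf : ∀ n, AEStronglyMeasurable (f n) P) {K : ℝ}
    (hK : ∀ n, ∫⁻ ω, ENNReal.ofReal (f n ω ^ 2) ∂P ≤ ENNReal.ofReal K)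
    (hlim : ∀ᵐ ω ∂P, Tendsto (fun n => f n ω) atTop (𝓝 (g ω))) {m : ℝ}
    (hm : ∀ n, ∫ ω, f n ω ∂P = m) :
    Integrable g P ∧ ∫ ω, g ω ∂P = m := by
  have hUI := uniformIntegrable_of_sq_le hf hK
  have hg := hUI.integrable_of_ae_tendsto hlim
  have hL := tendsto_Lp_finite_of_tendsto_ae le_rfl ENNReal.one_ne_top hf
    (memLp_one_iff_integrable.2 hg) hUI.unifIntegrable hlim
  have := tendsto_integral_of_L1' g hg.1
    (Eventually.of_forall fun n => memLp_one_iff_integrable.1 (hUI.memLp n)) hL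
  simp only [hm] at this
  exact ⟨hg, (tendsto_nhds_unique this tendsto_const_nhds)⟩

/-! ### The martingales of the cluster sizes -/

section Martingale

variable {Ω : Type*} {u : ℕ → Ω → ℕ} {ε : ℕ → Ω → ℝ} {i n : ℕ} {t q : ℝ}

/-- The number of vertices `j ≤ n` in `T_i(t)`. -/
noncomputable def clusterCount (u : ℕ → Ω → ℕ) (ε : ℕ → Ω → ℝ) (i : ℕ) (t : ℝ) (n : ℕ) (ω : Ω) :
    ℕ :=
  (cluster (fun j => u j ω) (fun j => ε j ω) i t ∩ Set.Icc 1 n).ncard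

lemma clusterCount_le (n : ℕ) (ω : Ω) : clusterCount u ε i t n ω ≤ n :=
  (Set.ncard_le_ncard Set.inter_subset_right (Set.finite_Icc 1 n)).trans
    (by simp [Set.ncard_eq_toFinset_card'])

lemma one_le_clusterCount (hi : 1 ≤ i) (hin : i ≤ n) (ω : Ω) : 1 ≤ clusterCount u ε i t n ω := by
  refine (Set.ncard_pos ((Set.finite_Icc 1 n).subset Set.inter_subset_right)).2 ?_
  exact ⟨i, mem_cluster_self _ _ _ _, hi, hin⟩

open Classical in
lemma countP_profile_unit (ω : Ω) :
    ((profile (fun _ : Unit => t) (fun j => u j ω) (fun j => ε j ω) i n).countP fun S => S ()) =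
      clusterCount u ε i t n ω :=
  countP_profile ()

lemma measurable_clusterCount (hu : ∀ ω, IsParentMap fun j => u j ω) (hi : 1 ≤ i) (n : ℕ) :
    Measurable[history u ε n] (clusterCount u ε i t n) := by
  classical
  have := measurable_profile (κ := Unit) (τ := fun _ => t) (ε := ε) hu hi n
    (fun M => M.countP fun S => S ())
  convert this using 2 with ω
  exact (countP_profile_unit ω).symm

lemma clusterCount_self (hu : ∀ ω, IsParentMap fun j => u j ω) (hi : 1 ≤ i) (ω : Ω) :
    clusterCount u ε i t i ω = 1 := by
  classical
  have h := countP_profile_unit (t := t) (u := u) (ε := ε) (i := i) (n := i) ω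
  rw [profile_self (hu ω) hi] at h
  rw [← h, Multiset.countP_eq_card.2 (by simp), Multiset.card_singleton]

variable [mΩ : MeasurableSpace Ω] {P : Measure Ω} [IsProbabilityMeasure P]

lemma IsDestruction.lintegral_gammaRatio_succ (h : IsDestruction P u ε)
    (hu : ∀ ω, IsParentMap fun j => u j ω) (hi : 1 ≤ i) (hin : i ≤ n) (ht : 0 ≤ t) (hq : -1 < q)
    {W : Ω → ENNReal} (hW : Measurable[history u ε n] W) :
    ∫⁻ ω, W ω * ENNReal.ofReal (gammaRatio q (clusterCount u ε i t (n + 1) ω)) ∂P =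
      ENNReal.ofReal (1 + Real.exp (-t) * q / n) *
        ∫⁻ ω, W ω * ENNReal.ofReal (gammaRatio q (clusterCount u ε i t n ω)) ∂P := by
  classical
  have key := h.lintegral_profile_succ (κ := Unit) (τ := fun _ => t) hu hi hin hW
    fun M => ENNReal.ofReal (gammaRatio q (M.countP fun S => S ()))
  simp only [countP_profile_unit] at key
  rw [key, ← lintegral_const_mul' _ _ ENNReal.ofReal_ne_top]
  refine lintegral_congr fun ω => ?_
  rw [transition_gammaRatio hq ht (hi.trans hin) card_profile_le
    (by rw [countP_profile_unit]; exact one_le_clusterCount hi hin ω), countP_profile_unit]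
  ring

/-- The martingale `Γ(N + q) / Γ(N)`, normalized, where `N` is the number of vertices `≤ i + m` of
the cluster of `i` at time `t`. -/
noncomputable def countMartingale (u : ℕ → Ω → ℕ) (ε : ℕ → Ω → ℝ) (i : ℕ) (t q : ℝ) (m : ℕ)
    (ω : Ω) : ℝ :=
  gammaRatio q (clusterCount u ε i t (i + m) ω) / gammaRatio (Real.exp (-t) * q) (i + m)

/-- Keeps the normalizing Gamma ratio positive for negative q, as needed for q = -1/2. -/
lemma neg_one_lt_exp_mul (ht : 0 ≤ t) (hq : -1 < q) : -1 < Real.exp (-t) * q := by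
  have h0 : 0 < Real.exp (-t) := Real.exp_pos _
  have h1 : Real.exp (-t) ≤ 1 := Real.exp_le_one_iff.2 (by linarith)
  nlinarith

omit mΩ in
lemma countMartingale_nonneg (ht : 0 ≤ t) (hq : -1 < q) (m : ℕ) (ω : Ω) :
    0 ≤ countMartingale u ε i t q m ω :=
  div_nonneg (gammaRatio_nonneg hq _) (gammaRatio_nonneg (neg_one_lt_exp_mul ht hq) _)

omit mΩ in
lemma measurable_countMartingale (hu : ∀ ω, IsParentMap fun j => u j ω) (hi : 1 ≤ i) (m : ℕ) :
    Measurable[history u ε (i + m)] (countMartingale u ε i t q m) := by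
  have h1 := (Measurable.of_discrete (f := fun N => gammaRatio q N)).comp
    (measurable_clusterCount (ε := ε) (t := t) hu hi (i + m))
  exact h1.div_const _

lemma IsDestruction.integrable_countMartingale (h : IsDestruction P u ε)
    (hu : ∀ ω, IsParentMap fun j => u j ω) (hi : 1 ≤ i) (m : ℕ) :
    Integrable (countMartingale u ε i t q m) P := by
  have hm := (measurable_countMartingale (ε := ε) (t := t) (q := q) hu hi m).mono
    (h.history_le _) le_rfl
  -- The count is at most `i + m`, so the variable takes finitely many values, each bounded by the
  -- sum of all their norms.
  refine Integrable.of_bound hm.aestronglyMeasurable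
    (∑ N ∈ Finset.range (i + m + 1), ‖gammaRatio q N‖ / ‖gammaRatio (Real.exp (-t) * q) (i + m)‖)
    (ae_of_all _ fun ω => ?_)
  rw [countMartingale, norm_div]
  refine Finset.single_le_sum (f := fun N =>
    ‖gammaRatio q N‖ / ‖gammaRatio (Real.exp (-t) * q) (i + m)‖) (fun _ _ => by positivity) ?_
  have := clusterCount_le (u := u) (ε := ε) (i := i) (t := t) (i + m) ω
  simp
  omega

/-- The normalization g_{aq}(n), with a = e^(-t), grows by exactly the factor 1 + a q / n gained in
mean by the numerator. -/
lemma IsDestruction.lintegral_countMartingale_succ (h : IsDestruction P u ε)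
    (hu : ∀ ω, IsParentMap fun j => u j ω) (hi : 1 ≤ i) (ht : 0 ≤ t) (hq : -1 < q) (m : ℕ)
    {W : Ω → ENNReal} (hW : Measurable[history u ε (i + m)] W) :
    ∫⁻ ω, W ω * ENNReal.ofReal (countMartingale u ε i t q (m + 1) ω) ∂P =
      ∫⁻ ω, W ω * ENNReal.ofReal (countMartingale u ε i t q m ω) ∂P := by
  have hq' := neg_one_lt_exp_mul ht hq
  have key := h.lintegral_gammaRatio_succ hu hi (Nat.le_add_right i m) ht hq hW
  have him : 1 ≤ i + m := by omega
  have him' : (1 : ℝ) ≤ (i + m : ℕ) := by exact_mod_cast him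
  have hc := gammaRatio_pos hq' him
  have hfac : 0 < 1 + Real.exp (-t) * q / (i + m : ℕ) := by
    rw [← mul_lt_mul_iff_right₀ (by linarith : (0 : ℝ) < (i + m : ℕ))]
    field_simp
    linarith
  have hpull : ∀ n, ∫⁻ ω, W ω * ENNReal.ofReal
      (gammaRatio q (clusterCount u ε i t n ω) / gammaRatio (Real.exp (-t) * q) n) ∂P =
      ENNReal.ofReal (gammaRatio (Real.exp (-t) * q) n)⁻¹ *
        ∫⁻ ω, W ω * ENNReal.ofReal (gammaRatio q (clusterCount u ε i t n ω)) ∂P := by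
    intro n
    rw [← lintegral_const_mul' _ _ ENNReal.ofReal_ne_top]
    refine lintegral_congr fun ω => ?_
    rw [div_eq_inv_mul, ENNReal.ofReal_mul (inv_nonneg.2 (gammaRatio_nonneg hq' _))]
    ring
  simp only [countMartingale]
  rw [← add_assoc, hpull, hpull, key, ← mul_assoc,
    ← ENNReal.ofReal_mul (inv_nonneg.2 (gammaRatio_nonneg hq' _)), gammaRatio_succ hq' him]
  have hne : ((i + m : ℕ) : ℝ) + Real.exp (-t) * q ≠ 0 := by linarith
  congr 2
  field_simp

lemma IsDestruction.lintegral_countMartingale (h : IsDestruction P u ε)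
    (hu : ∀ ω, IsParentMap fun j => u j ω) (hi : 1 ≤ i) (ht : 0 ≤ t) (hq : -1 < q) (m : ℕ) :
    ∫⁻ ω, ENNReal.ofReal (countMartingale u ε i t q m ω) ∂P =
      ENNReal.ofReal (Real.Gamma (q + 1) / gammaRatio (Real.exp (-t) * q) i) := by
  induction m with
  | zero => simp [countMartingale, clusterCount_self hu hi, gammaRatio_one_right]
  | succ m ih =>
    rw [← ih]
    simpa only [one_mul] using
      h.lintegral_countMartingale_succ hu hi ht hq m (W := fun _ => 1) measurable_const

lemma IsDestruction.integral_countMartingale (h : IsDestruction P u ε)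
    (hu : ∀ ω, IsParentMap fun j => u j ω) (hi : 1 ≤ i) (ht : 0 ≤ t) (hq : -1 < q) (m : ℕ) :
    ∫ ω, countMartingale u ε i t q m ω ∂P =
      Real.Gamma (q + 1) / gammaRatio (Real.exp (-t) * q) i := by
  rw [integral_eq_lintegral_of_nonneg_ae
    (ae_of_all _ fun ω => countMartingale_nonneg ht hq m ω)
    (h.integrable_countMartingale hu hi m).1, h.lintegral_countMartingale hu hi ht hq,
    ENNReal.toReal_ofReal]
  exact div_nonneg (Real.Gamma_pos_of_pos (by linarith)).le
    (gammaRatio_nonneg (neg_one_lt_exp_mul ht hq) _)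

lemma IsDestruction.martingale_countMartingale (h : IsDestruction P u ε)
    (hu : ∀ ω, IsParentMap fun j => u j ω) (hi : 1 ≤ i) (ht : 0 ≤ t) (hq : -1 < q) :
    Martingale (countMartingale u ε i t q)
      (⟨fun m => history u ε (i + m), fun _ _ hmn => history_mono (Nat.add_le_add_left hmn i),
        fun _ => h.history_le _⟩ : Filtration ℕ mΩ) P := by
  refine martingale_of_setIntegral_eq_succ
    (fun m => (measurable_countMartingale hu hi m).stronglyMeasurable)
    (fun m => h.integrable_countMartingale hu hi m) fun m s hs => ?_
  have hs' : MeasurableSet[history u ε (i + m)] s := hs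
  have hsm := h.history_le _ s hs'
  have hW : Measurable[history u ε (i + m)] (s.indicator fun _ => (1 : ENNReal)) :=
    measurable_const.indicator hs'
  have key := h.lintegral_countMartingale_succ hu hi ht hq m hW
  have hset : ∀ k, ∫ ω in s, countMartingale u ε i t q k ω ∂P = (∫⁻ ω,
      s.indicator (fun _ => (1 : ENNReal)) ω * ENNReal.ofReal (countMartingale u ε i t q k ω)
        ∂P).toReal := by
    intro k
    rw [integral_eq_lintegral_of_nonneg_ae
      (ae_of_all _ fun ω => countMartingale_nonneg ht hq k ω)
      (h.integrable_countMartingale hu hi k).1.restrict, ← lintegral_indicator hsm]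
    congr 1
    refine lintegral_congr fun ω => ?_
    by_cases hω : ω ∈ s <;> simp [hω]
  rw [hset, hset, key]

/-- A nonnegative martingale is bounded in L¹ by its constant mean, so Doob's convergence theorem
applies. -/
lemma IsDestruction.ae_tendsto_countMartingale (h : IsDestruction P u ε)
    (hu : ∀ ω, IsParentMap fun j => u j ω) (hi : 1 ≤ i) (ht : 0 ≤ t) (hq : -1 < q) :
    ∀ᵐ ω ∂P, ∃ c, Tendsto (fun m => countMartingale u ε i t q m ω) atTop (𝓝 c) := by
  refine (h.martingale_countMartingale hu hi ht hq).submartingale.exists_ae_tendsto_of_bdd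
    (R := (Real.Gamma (q + 1) / gammaRatio (Real.exp (-t) * q) i).toNNReal) fun m => ?_
  rw [eLpNorm_one_eq_lintegral_enorm]
  refine le_of_eq ?_
  rw [← ENNReal.ofReal, ← h.lintegral_countMartingale hu hi ht hq m]
  refine lintegral_congr fun ω => ?_
  rw [Real.enorm_eq_ofReal (countMartingale_nonneg ht hq m ω)]

end Martingale

/-! ### Existence, positivity and moments of the weights -/

section Limit

variable {Ω : Type*} {u : ℕ → Ω → ℕ} {ε : ℕ → Ω → ℝ} {i n : ℕ} {t q : ℝ}

lemma scaledCount_eq (ω : Ω) (n : ℕ) :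
    scaledCount (cluster (fun j => u j ω) (fun j => ε j ω) i t) t n =
      clusterCount u ε i t n ω / (n : ℝ) ^ Real.exp (-t) := by
  rw [scaledCount, Real.rpow_neg (by positivity), clusterCount, div_eq_inv_mul]

/-- The limit of `n ^ (a q) / (Γ(n + a q) / Γ(n))` along `n = i + m`. -/
lemma tendsto_rpow_div_gammaRatio (ht : 0 ≤ t) (hq : -1 < q) (i : ℕ) :
    Tendsto (fun m : ℕ => gammaRatio (Real.exp (-t) * q) (i + m) /
      ((i + m : ℕ) : ℝ) ^ (Real.exp (-t) * q)) atTop (𝓝 1) := by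
  have := (tendsto_gammaRatio_div (neg_one_lt_exp_mul ht hq)).comp
    (tendsto_add_atTop_nat i)
  simpa only [Function.comp_def, add_comm _ i] using this

lemma tendsto_gammaRatio_clusterCount_div (hi : 1 ≤ i) (ht : 0 ≤ t) (hq : -1 < q) {ω : Ω} {x : ℝ}
    (hx : Tendsto (fun m => countMartingale u ε i t q m ω) atTop (𝓝 x)) :
    Tendsto (fun m : ℕ => gammaRatio q (clusterCount u ε i t (i + m) ω) /
      ((i + m : ℕ) : ℝ) ^ (Real.exp (-t) * q)) atTop (𝓝 x) := by
  have h1 := hx.mul (tendsto_rpow_div_gammaRatio ht hq i)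
  rw [mul_one] at h1
  refine h1.congr fun m => ?_
  rw [countMartingale, div_mul_div_cancel₀
    (gammaRatio_pos (neg_one_lt_exp_mul ht hq) (by omega : 1 ≤ i + m)).ne']

/-- Up to constants, the martingale for -1/2 is the inverse square root of the scaled count. The
product of √(N / n^a) with it stays above a constant c > 0, so √x · y ≥ c for the limits, and x
cannot vanish. -/
lemma exists_pos_tendsto_of_countMartingale (hi : 1 ≤ i) (ht : 0 ≤ t) {ω : Ω} {x y : ℝ}
    (hx : Tendsto (fun m => countMartingale u ε i t 1 m ω) atTop (𝓝 x))
    (hy : Tendsto (fun m => countMartingale u ε i t (-1 / 2) m ω) atTop (𝓝 y)) :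
    0 < x ∧ Tendsto (scaledCount (cluster (fun j => u j ω) (fun j => ε j ω) i t) t) atTop
      (𝓝 x) := by
  have hlim := tendsto_gammaRatio_clusterCount_div hi ht (by norm_num) hx
  have hneg := tendsto_gammaRatio_clusterCount_div hi ht (by norm_num) hy
  set a := Real.exp (-t) with ha
  simp only [gammaRatio_one_left, mul_one] at hlim
  obtain ⟨c, C, hc, -, hbd⟩ := exists_gammaRatio_bounds (q := -1 / 2) (by norm_num)
  have hx0 : 0 ≤ x := ge_of_tendsto' hlim fun m => by positivity
  have hprod := (hlim.rpow_const (p := 1 / 2) (.inr (by norm_num))).mul hneg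
  have hle : c ≤ x ^ (1 / 2 : ℝ) * y := by
    refine ge_of_tendsto' hprod fun m => ?_
    have hN : 1 ≤ clusterCount u ε i t (i + m) ω := one_le_clusterCount hi (by omega) ω
    have hN' : (0 : ℝ) < clusterCount u ε i t (i + m) ω := by exact_mod_cast hN
    have hn' : (0 : ℝ) < (i + m : ℕ) := by exact_mod_cast (by omega : 0 < i + m)
    have h1 := (hbd _ hN).1
    have h2 : c ≤ (clusterCount u ε i t (i + m) ω : ℝ) ^ (1 / 2 : ℝ) *
        gammaRatio (-1 / 2) (clusterCount u ε i t (i + m) ω) := by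
      calc c = (clusterCount u ε i t (i + m) ω : ℝ) ^ (1 / 2 : ℝ) *
            (c * (clusterCount u ε i t (i + m) ω : ℝ) ^ (-1 / 2 : ℝ)) := by
            rw [mul_left_comm, ← Real.rpow_add hN']
            norm_num
        _ ≤ _ := by gcongr
    refine h2.trans (le_of_eq ?_)
    rw [Real.div_rpow hN'.le (by positivity), ← Real.rpow_mul hn'.le, div_mul_div_comm,
      ← Real.rpow_add hn', show a * (1 / 2) + a * (-1 / 2) = 0 by ring, Real.rpow_zero, div_one]
  have hx1 : x ≠ 0 := by
    rintro rfl
    rw [Real.zero_rpow (by norm_num), zero_mul] at hle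
    linarith
  refine ⟨lt_of_le_of_ne hx0 hx1.symm, ?_⟩
  rw [← tendsto_add_atTop_iff_nat i]
  simpa only [scaledCount_eq, add_comm _ i] using hlim

variable [mΩ : MeasurableSpace Ω] {P : Measure Ω} [IsProbabilityMeasure P]

lemma IsDestruction.ae_tendsto_scaledCount (h : IsDestruction P u ε)
    (hu : ∀ ω, IsParentMap fun j => u j ω) (hi : 1 ≤ i) (ht : 0 ≤ t) :
    ∀ᵐ ω ∂P, 0 < rho u ε i t ω ∧
      Tendsto (scaledCount (cluster (fun j => u j ω) (fun j => ε j ω) i t) t) atTop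
        (𝓝 (rho u ε i t ω)) := by
  filter_upwards [h.ae_tendsto_countMartingale hu hi ht (q := 1) (by norm_num),
    h.ae_tendsto_countMartingale hu hi ht (q := -1 / 2) (by norm_num)] with ω ⟨x, hx⟩ ⟨y, hy⟩
  obtain ⟨h1, h2⟩ := exists_pos_tendsto_of_countMartingale hi ht hx hy
  rw [rho, weight, h2.limUnder_eq]
  exact ⟨h1, h2⟩

omit mΩ in
lemma tendsto_clusterCount_atTop {ω : Ω} {x : ℝ} (hx : 0 < x)
    (hlim : Tendsto (scaledCount (cluster (fun j => u j ω) (fun j => ε j ω) i t) t) atTop (𝓝 x)) :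
    Tendsto (fun n => clusterCount u ε i t n ω) atTop atTop := by
  rw [← tendsto_natCast_atTop_iff (R := ℝ)]
  have h1 := (tendsto_rpow_atTop (Real.exp_pos (-t))).comp tendsto_natCast_atTop_atTop
  refine (hlim.pos_mul_atTop hx h1).congr' ?_
  filter_upwards [eventually_ge_atTop 1] with n hn
  have : (0 : ℝ) < (n : ℝ) ^ Real.exp (-t) := Real.rpow_pos_of_pos (by exact_mod_cast hn) _
  rw [scaledCount_eq, Function.comp_apply, div_mul_cancel₀ _ this.ne']

-- Positivity of the limit forces the count to infinity, so that both Gamma ratios may be replaced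
-- by powers.
omit mΩ in
lemma tendsto_countMartingale_rpow (hi : 1 ≤ i) (ht : 0 ≤ t) (hq : 0 ≤ q) {ω : Ω} {x : ℝ}
    (hx : 0 < x)
    (hlim : Tendsto (scaledCount (cluster (fun j => u j ω) (fun j => ε j ω) i t) t) atTop (𝓝 x)) :
    Tendsto (fun m => countMartingale u ε i t q m ω) atTop (𝓝 (x ^ q)) := by
  have hq1 : -1 < q := by linarith
  have hshift : Tendsto (fun m => i + m) atTop atTop := tendsto_add_atTop_nat i |>.congr fun m =>
    add_comm m i
  have h1 := (tendsto_gammaRatio_div hq1).comp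
    ((tendsto_clusterCount_atTop hx hlim).comp hshift)
  have h2 := (hlim.rpow_const (p := q) (.inr hq)).comp hshift
  have h3 := (tendsto_rpow_div_gammaRatio ht hq1 i).inv₀ one_ne_zero
  have h4 := (h1.mul h2).mul h3
  rw [one_mul, inv_one, mul_one] at h4
  refine h4.congr fun m => ?_
  have hN : 1 ≤ clusterCount u ε i t (i + m) ω := one_le_clusterCount hi (by omega) ω
  have hN' : (0 : ℝ) < clusterCount u ε i t (i + m) ω := by exact_mod_cast hN
  have hn' : (0 : ℝ) < (i + m : ℕ) := by exact_mod_cast (by omega : 0 < i + m)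
  have hc := gammaRatio_pos (neg_one_lt_exp_mul ht hq1) (by omega : 1 ≤ i + m)
  simp only [Function.comp_apply, scaledCount_eq, countMartingale]
  rw [Real.div_rpow hN'.le (by positivity), ← Real.rpow_mul hn'.le]
  have e1 : (clusterCount u ε i t (i + m) ω : ℝ) ^ q ≠ 0 := (Real.rpow_pos_of_pos hN' q).ne'
  have e2 : ((i + m : ℕ) : ℝ) ^ (Real.exp (-t) * q) ≠ 0 := (Real.rpow_pos_of_pos hn' _).ne'
  field_simp

/-- Both sides are of order n^(2q). One inequality serves the numerator of the martingale, the other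
its normalization. -/
lemma exists_gammaRatio_sq_le (hq : 0 ≤ q) :
    ∃ K : ℝ, 0 < K ∧ ∀ n : ℕ, 1 ≤ n →
      gammaRatio q n ^ 2 ≤ K * gammaRatio (2 * q) n ∧
      gammaRatio (2 * q) n ≤ K * gammaRatio q n ^ 2 := by
  obtain ⟨c, C, hc, hC, h⟩ := exists_gammaRatio_bounds (q := q) (by linarith)
  obtain ⟨c', C', hc', hC', h'⟩ := exists_gammaRatio_bounds (q := 2 * q) (by linarith)
  refine ⟨C ^ 2 / c' + C' / c ^ 2, by positivity, fun n hn => ?_⟩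
  have hn' : (0 : ℝ) < n := by exact_mod_cast hn
  have hpow : (n : ℝ) ^ (2 * q) = ((n : ℝ) ^ q) ^ 2 := by
    rw [mul_comm, Real.rpow_mul hn'.le]
    norm_cast
  obtain ⟨h1, h2⟩ := h n hn
  obtain ⟨h3, h4⟩ := h' n hn
  rw [hpow] at h3 h4
  have hz : 0 < (n : ℝ) ^ q := Real.rpow_pos_of_pos hn' q
  have hg := gammaRatio_pos (q := q) (by linarith) hn
  have hg' := gammaRatio_pos (q := 2 * q) (by linarith) hn
  constructor
  · calc gammaRatio q n ^ 2 ≤ (C * (n : ℝ) ^ q) ^ 2 := by gcongr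
      _ = C ^ 2 / c' * (c' * ((n : ℝ) ^ q) ^ 2) := by field_simp
      _ ≤ C ^ 2 / c' * gammaRatio (2 * q) n := by gcongr
      _ ≤ _ := by gcongr; exact le_add_of_nonneg_right (by positivity)
  · calc gammaRatio (2 * q) n ≤ C' * ((n : ℝ) ^ q) ^ 2 := h4
      _ = C' / c ^ 2 * (c * (n : ℝ) ^ q) ^ 2 := by field_simp
      _ ≤ C' / c ^ 2 * gammaRatio q n ^ 2 := by gcongr
      _ ≤ _ := by gcongr; exact le_add_of_nonneg_left (by positivity)

omit mΩ in
lemma exists_countMartingale_sq_le (hi : 1 ≤ i) (hq : 0 ≤ q) :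
    ∃ K : ℝ, 0 < K ∧ ∀ m (ω : Ω), countMartingale u ε i t q m ω ^ 2 ≤
      K * countMartingale u ε i t (2 * q) m ω := by
  have ha : 0 ≤ Real.exp (-t) * q := mul_nonneg (Real.exp_nonneg _) hq
  obtain ⟨K, hK, h⟩ := exists_gammaRatio_sq_le hq
  obtain ⟨K', hK', h'⟩ := exists_gammaRatio_sq_le ha
  refine ⟨K * K', by positivity, fun m ω => ?_⟩
  have him : 1 ≤ i + m := by omega
  have h1 := (h _ (one_le_clusterCount (u := u) (ε := ε) (t := t) hi (Nat.le_add_right i m) ω)).1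
  have h2 := (h' _ him).2
  have hc := gammaRatio_pos (q := Real.exp (-t) * q) (by linarith) him
  have hc' := gammaRatio_pos (q := 2 * (Real.exp (-t) * q)) (by linarith) him
  have hg := gammaRatio_nonneg (q := 2 * q) (by linarith) (clusterCount u ε i t (i + m) ω)
  rw [countMartingale, countMartingale, div_pow, mul_left_comm (Real.exp (-t)),
    div_le_iff₀ (by positivity)]
  calc _ ≤ K * gammaRatio (2 * q) (clusterCount u ε i t (i + m) ω) * 1 := by rw [mul_one]; exact h1
    _ ≤ K * gammaRatio (2 * q) (clusterCount u ε i t (i + m) ω) *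
        (K' * gammaRatio (Real.exp (-t) * q) (i + m) ^ 2 /
          gammaRatio (2 * (Real.exp (-t) * q)) (i + m)) := by
      gcongr
      exact (one_le_div hc').2 h2
    _ = _ := by ring

/-- The moments of the limiting weights. -/
lemma IsDestruction.integral_rho_rpow (h : IsDestruction P u ε)
    (hu : ∀ ω, IsParentMap fun j => u j ω) (hi : 1 ≤ i) (ht : 0 ≤ t) (hq : 0 ≤ q) :
    Integrable (fun ω => rho u ε i t ω ^ q) P ∧ ∫ ω, rho u ε i t ω ^ q ∂P =
      Real.Gamma (q + 1) * Real.Gamma i / Real.Gamma (Real.exp (-t) * q + i) := by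
  obtain ⟨K, hK, hsq⟩ := exists_countMartingale_sq_le (u := u) (ε := ε) (t := t) hi hq
  have hval : Real.Gamma (q + 1) * Real.Gamma i / Real.Gamma (Real.exp (-t) * q + i) =
      Real.Gamma (q + 1) / gammaRatio (Real.exp (-t) * q) i := by
    rw [gammaRatio, div_div_eq_mul_div, add_comm (Real.exp (-t) * q)]
  rw [hval]
  -- The second moments are at most `K` times the mean of the martingale for `2 * q`, which does not
  -- depend on `m`.
  refine integral_of_tendsto_of_sq_le
    (fun m => (h.integrable_countMartingale (t := t) (q := q) hu hi m).1)
    (K := K * (Real.Gamma (2 * q + 1) / gammaRatio (Real.exp (-t) * (2 * q)) i)) (fun m => ?_) ?_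
    fun m => h.integral_countMartingale hu hi ht (by linarith) m
  · rw [ENNReal.ofReal_mul hK.le, ← h.lintegral_countMartingale hu hi ht (by linarith) m,
      ← lintegral_const_mul' _ _ ENNReal.ofReal_ne_top]
    refine lintegral_mono fun ω => ?_
    rw [← ENNReal.ofReal_mul hK.le]
    exact ENNReal.ofReal_le_ofReal (hsq m ω)
  · filter_upwards [h.ae_tendsto_scaledCount hu hi ht] with ω hω
    exact tendsto_countMartingale_rpow hi ht hq hω.1 hω.2

end Limit

/-! ### The moment problem on the unit interval -/

section Moments

lemma abs_pow_le_one_of_mem_Icc {x : ℝ} (hx : x ∈ Set.Icc (0 : ℝ) 1) (k : ℕ) : ‖x ^ k‖ ≤ 1 := by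
  rw [norm_pow, Real.norm_of_nonneg hx.1]
  exact pow_le_one₀ hx.1 hx.2

lemma integrable_pow_of_ae_mem_Icc {μ : Measure ℝ} [IsProbabilityMeasure μ]
    (hμ : ∀ᵐ x ∂μ, x ∈ Set.Icc (0 : ℝ) 1) (k : ℕ) : Integrable (fun x : ℝ => x ^ k) μ := by
  refine Integrable.of_bound (by fun_prop) 1 ?_
  filter_upwards [hμ] with x hx
  exact abs_pow_le_one_of_mem_Icc hx k

lemma integral_polynomial_eval {μ : Measure ℝ} [IsProbabilityMeasure μ]
    (hμ : ∀ᵐ x ∂μ, x ∈ Set.Icc (0 : ℝ) 1) (p : Polynomial ℝ) :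
    Integrable (fun x => p.eval x) μ ∧ ∫ x, p.eval x ∂μ =
      ∑ k ∈ Finset.range (p.natDegree + 1), p.coeff k * ∫ x, x ^ k ∂μ := by
  simp only [Polynomial.eval_eq_sum_range]
  have hint : ∀ k ∈ Finset.range (p.natDegree + 1),
      Integrable (fun x : ℝ => p.coeff k * x ^ k) μ := fun k _ =>
    (integrable_pow_of_ae_mem_Icc hμ k).const_mul _
  refine ⟨integrable_finsetSum _ hint, ?_⟩
  rw [integral_finsetSum _ hint]
  exact Finset.sum_congr rfl fun k _ => integral_const_mul _ _

/-- A probability measure on the unit interval is determined by its moments. -/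
lemma measure_eq_of_moments {μ ν : Measure ℝ} [IsProbabilityMeasure μ] [IsProbabilityMeasure ν]
    (hμ : ∀ᵐ x ∂μ, x ∈ Set.Icc (0 : ℝ) 1) (hν : ∀ᵐ x ∂ν, x ∈ Set.Icc (0 : ℝ) 1)
    (h : ∀ k : ℕ, ∫ x, x ^ k ∂μ = ∫ x, x ^ k ∂ν) : μ = ν := by
  refine ext_of_forall_integral_eq_of_IsFiniteMeasure fun f => ?_
  have hclose : ∀ (ρ : Measure ℝ) [IsProbabilityMeasure ρ], (∀ᵐ x ∂ρ, x ∈ Set.Icc (0 : ℝ) 1) →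
      ∀ (δ : ℝ) (p : Polynomial ℝ), (∀ x ∈ Set.Icc (0 : ℝ) 1, |p.eval x - f x| < δ) →
      |∫ x, p.eval x ∂ρ - ∫ x, f x ∂ρ| ≤ δ := by
    intro ρ _ hρ δ p hp
    rw [← integral_sub (integral_polynomial_eval hρ p).1 (f.integrable ρ), ← Real.norm_eq_abs]
    refine (norm_integral_le_of_norm_le_const (C := δ) ?_).trans (by simp)
    filter_upwards [hρ] with x hx
    exact (hp x hx).le
  refine eq_of_abs_sub_nonpos (le_of_forall_pos_le_add fun δ hδ => ?_)
  obtain ⟨p, hp⟩ := exists_polynomial_near_of_continuousOn 0 1 f f.continuous.continuousOn (δ / 2)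
    (half_pos hδ)
  have h1 := abs_le.1 (hclose μ hμ _ p hp)
  have h2 := abs_le.1 (hclose ν hν _ p hp)
  have h3 : ∫ x, p.eval x ∂μ = ∫ x, p.eval x ∂ν := by
    rw [(integral_polynomial_eval hμ p).2, (integral_polynomial_eval hν p).2]
    simp only [h]
  rw [zero_add, abs_le]
  constructor <;> linarith [h1.1, h1.2, h2.1, h2.2]

end Moments

/-! ### The beta law of the density of a subtree -/

section BetaLaw

lemma isProbabilityMeasure_betaLaw {i : ℕ} (hi : 1 ≤ i) : IsProbabilityMeasure (betaLaw i) := by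
  rw [betaLaw]
  split_ifs with h
  · infer_instance
  · have : (2 : ℝ) ≤ i := by exact_mod_cast (by omega : 2 ≤ i)
    exact isProbabilityMeasureBeta one_pos (by linarith)

lemma ae_betaLaw_mem_Icc (i : ℕ) : ∀ᵐ x ∂(betaLaw i), x ∈ Set.Icc (0 : ℝ) 1 := by
  rw [betaLaw]
  split_ifs with h
  · exact (ae_dirac_iff (p := fun x => x ∈ Set.Icc (0 : ℝ) 1) measurableSet_Icc).2 (by simp)
  · rw [betaMeasure, ae_withDensity_iff (by unfold betaPDF; fun_prop)]
    refine ae_of_all _ fun x hx => ?_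
    constructor
    · by_contra hc
      exact hx (betaPDF_eq_zero_of_nonpos (not_le.1 hc).le)
    · by_contra hc
      exact hx (betaPDF_eq_zero_of_one_le (not_le.1 hc).le)

/-- Multiplying the Beta(1, b) density by x^k gives a multiple of the Beta(k + 1, b) density, whose
total mass is 1. -/
lemma lintegral_rpow_betaMeasure {b : ℝ} (hb : 0 < b) (k : ℕ) :
    ∫⁻ x, ENNReal.ofReal (x ^ k) ∂(betaMeasure 1 b) =
      ENNReal.ofReal (beta (k + 1) b / beta 1 b) := by
  have hk : (0 : ℝ) < k + 1 := by positivity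
  have hB := beta_pos hk hb
  have hB1 := beta_pos one_pos hb
  rw [betaMeasure, lintegral_withDensity_eq_lintegral_mul _ (by unfold betaPDF; fun_prop)
    (by fun_prop)]
  have : ∀ x, (betaPDF 1 b * fun x => ENNReal.ofReal (x ^ k)) x =
      ENNReal.ofReal (beta (k + 1) b / beta 1 b) * betaPDF (k + 1) b x := by
    intro x
    rw [Pi.mul_apply, betaPDF_eq, betaPDF_eq]
    split_ifs with hx
    · rw [← ENNReal.ofReal_mul' (pow_nonneg hx.1.le k), ← ENNReal.ofReal_mul (by positivity)]
      congr 1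
      rw [sub_self, Real.rpow_zero, add_sub_cancel_right, Real.rpow_natCast]
      field_simp
    · simp
  rw [lintegral_congr this, lintegral_const_mul' _ _ ENNReal.ofReal_ne_top,
    lintegral_betaPDF_eq_one hk hb, mul_one]

lemma integral_pow_betaLaw {i : ℕ} (hi : 1 ≤ i) (k : ℕ) :
    ∫ x, x ^ k ∂(betaLaw i) = Real.Gamma (k + 1) * Real.Gamma i / Real.Gamma (k + i) := by
  have hae := ae_betaLaw_mem_Icc i
  rw [integral_eq_lintegral_of_nonneg_ae (by
    filter_upwards [hae] with x hx
    exact pow_nonneg hx.1 k) (by fun_prop)]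
  have hk : (0 : ℝ) < k + 1 := by positivity
  have hG := Real.Gamma_pos_of_pos hk
  rw [betaLaw]
  split_ifs with h
  · subst h
    rw [lintegral_dirac]
    simp [hG.ne']
  · have hi2 : (2 : ℝ) ≤ i := by exact_mod_cast (by omega : 2 ≤ i)
    have hb : (0 : ℝ) < i - 1 := by linarith
    have hGb := (Real.Gamma_pos_of_pos hb).ne'
    rw [lintegral_rpow_betaMeasure hb, ENNReal.toReal_ofReal
      (div_nonneg (beta_pos hk hb).le (beta_pos one_pos hb).le), beta, beta, Real.Gamma_one,
      add_sub_cancel, show (k : ℝ) + 1 + (i - 1) = k + i by ring]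
    have hGi := (Real.Gamma_pos_of_pos (by linarith : (0 : ℝ) < i)).ne'
    have hGki := (Real.Gamma_pos_of_pos (by positivity : (0 : ℝ) < k + i)).ne'
    field_simp

variable {Ω : Type*} [mΩ : MeasurableSpace Ω] {P : Measure Ω} [IsProbabilityMeasure P]
  {u : ℕ → Ω → ℕ} {ε : ℕ → Ω → ℝ} {i : ℕ}

omit [IsProbabilityMeasure P] in
lemma IsDestruction.measurable_rho (h : IsDestruction P u ε)
    (hu : ∀ ω, IsParentMap fun j => u j ω) (hi : 1 ≤ i) (t : ℝ) : Measurable (rho u ε i t) := by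
  refine (StronglyMeasurable.limUnder (f := fun n ω =>
    scaledCount (cluster (fun j => u j ω) (fun j => ε j ω) i t) t n) fun n => ?_).measurable
  simp only [scaledCount_eq]
  have := (measurable_clusterCount (ε := ε) (t := t) hu hi n).mono (h.history_le n) le_rfl
  exact (((Measurable.of_discrete (f := fun N : ℕ => (N : ℝ))).comp this).div_const
    _).stronglyMeasurable

lemma IsDestruction.ae_rho_zero_mem_Icc (h : IsDestruction P u ε)
    (hu : ∀ ω, IsParentMap fun j => u j ω) (hi : 1 ≤ i) :
    ∀ᵐ ω ∂P, rho u ε i 0 ω ∈ Set.Icc (0 : ℝ) 1 := by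
  filter_upwards [h.ae_tendsto_scaledCount hu hi le_rfl] with ω hω
  refine ⟨hω.1.le, le_of_tendsto' hω.2 fun n => ?_⟩
  rw [scaledCount_eq, neg_zero, Real.exp_zero, Real.rpow_one]
  exact div_le_one_of_le₀ (by exact_mod_cast clusterCount_le n ω) (by positivity)

/-- The asymptotic proportion of the subtree of `i` has the beta distribution. -/
lemma IsDestruction.map_rho_zero (h : IsDestruction P u ε)
    (hu : ∀ ω, IsParentMap fun j => u j ω) (hi : 1 ≤ i) :
    P.map (rho u ε i 0) = betaLaw i := by
  have hm := h.measurable_rho hu hi 0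
  have := isProbabilityMeasure_betaLaw hi
  have : IsProbabilityMeasure (P.map (rho u ε i 0)) :=
    Measure.isProbabilityMeasure_map hm.aemeasurable
  refine measure_eq_of_moments ?_ (ae_betaLaw_mem_Icc i) fun k => ?_
  · exact (ae_map_iff (p := fun x => x ∈ Set.Icc (0 : ℝ) 1) hm.aemeasurable measurableSet_Icc).2
      (h.ae_rho_zero_mem_Icc hu hi)
  · rw [integral_pow_betaLaw hi, integral_map hm.aemeasurable (by fun_prop)]
    have := (h.integral_rho_rpow hu hi le_rfl (q := k) (by positivity)).2
    simpa only [neg_zero, Real.exp_zero, one_mul, Real.rpow_natCast] using this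

end BetaLaw

/-! ### Identification of the law of the process -/

section Law

variable {Ω : Type*} [mΩ : MeasurableSpace Ω] {P : Measure Ω} [IsProbabilityMeasure P]
  {u : ℕ → Ω → ℕ} {ε : ℕ → Ω → ℝ} {i : ℕ}

lemma tendsto_lintegral_boundedContinuous {Ω' E : Type*} [MeasurableSpace Ω'] {Q : Measure Ω'}
    [IsProbabilityMeasure Q] [TopologicalSpace E] [MeasurableSpace E] [OpensMeasurableSpace E]
    (F : BoundedContinuousFunction E ℝ≥0) {Y : ℕ → Ω' → E} {Z : Ω' → E}
    (hY : ∀ n, Measurable (Y n)) (h : ∀ᵐ ω ∂Q, Tendsto (fun n => Y n ω) atTop (𝓝 (Z ω))) :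
    Tendsto (fun n => ∫⁻ ω, F (Y n ω) ∂Q) atTop (𝓝 (∫⁻ ω, F (Z ω) ∂Q)) := by
  refine tendsto_lintegral_of_dominated_convergence (fun _ => (nndist F 0 : ENNReal))
    (fun n => (F.continuous.measurable.comp (hY n)).coe_nnreal_ennreal) (fun n => ?_) (by simp) ?_
  · exact ae_of_all _ fun ω =>
      ENNReal.coe_le_coe.2 (BoundedContinuousFunction.NNReal.upper_bound F _)
  · filter_upwards [h] with ω hω
    exact (ENNReal.continuous_coe.comp F.continuous).continuousAt.tendsto.comp hω

open Classical in
/-- The scaled counts of the clusters at the times in `I`, as a function of the profile. -/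
noncomputable def scaledProfile (I : Finset ℝ≥0) (n : ℕ) (M : Multiset (I → Prop)) : I → ℝ :=
  fun k => (M.countP fun S => S k) / (n : ℝ) ^ Real.exp (-(k : ℝ))

-- The scale `n` and the time `m` are separate because the root profile will be read at the size of
-- the subtree of `i` while still being normalized by powers of `n`.
omit mΩ in
lemma scaledProfile_profile (I : Finset ℝ≥0) (n m : ℕ) (ω : Ω) (k : I) :
    scaledProfile I n (profile (fun k : I => (k : ℝ)) (fun j => u j ω) (fun j => ε j ω) i m) k =
      clusterCount u ε i (k : ℝ) m ω / (n : ℝ) ^ Real.exp (-(k : ℝ)) := by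
  rw [scaledProfile, countP_profile, clusterCount]

omit mΩ in
lemma card_profile_eq_clusterCount (hu : ∀ ω, IsParentMap fun j => u j ω)
    (hε : ∀ ω j, 2 ≤ j → 0 < ε j ω) {κ : Type*} (τ : κ → ℝ) (n : ℕ) (ω : Ω) :
    (profile τ (fun j => u j ω) (fun j => ε j ω) i n).card = clusterCount u ε i 0 n ω := by
  classical
  rw [card_profile, clusterCount, cluster_zero (hu ω) (hε ω), ← Set.ncard_coe_finset]
  congr 1
  ext v
  simp [and_comm]

lemma IsDestruction.ae_tendsto_scaledProfile (h : IsDestruction P u ε)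
    (hu : ∀ ω, IsParentMap fun j => u j ω) (hi : 1 ≤ i) (I : Finset ℝ≥0) :
    ∀ᵐ ω ∂P, Tendsto (fun n => scaledProfile I n
      (profile (fun k : I => (k : ℝ)) (fun j => u j ω) (fun j => ε j ω) i n)) atTop
      (𝓝 fun k : I => rho u ε i (k : ℝ) ω) := by
  have hall : ∀ᵐ ω ∂P, ∀ k : I, Tendsto (scaledCount
      (cluster (fun j => u j ω) (fun j => ε j ω) i (k : ℝ)) (k : ℝ)) atTop
        (𝓝 (rho u ε i (k : ℝ) ω)) := by
    rw [ae_all_iff]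
    intro k
    filter_upwards [h.ae_tendsto_scaledCount hu hi (t := ((k : ℝ≥0) : ℝ)) (NNReal.coe_nonneg _)]
      with ω hω
    exact hω.2
  filter_upwards [hall] with ω hω
  rw [tendsto_pi_nhds]
  intro k
  simp only [scaledProfile_profile]
  exact (hω k).congr fun n => scaledCount_eq ω n

omit mΩ in
/-- Sampling the scaled counts of a cluster along a sequence with a given asymptotic density. -/
lemma tendsto_clusterCount_comp {t x b : ℝ} {A : ℕ → ℕ} {ω : Ω} (hA : Tendsto A atTop atTop)
    (hb : Tendsto (fun n => (A n : ℝ) / n) atTop (𝓝 b))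
    (hx : Tendsto (scaledCount (cluster (fun j => u j ω) (fun j => ε j ω) i t) t) atTop (𝓝 x)) :
    Tendsto (fun n : ℕ => clusterCount u ε i t (A n) ω / (n : ℝ) ^ Real.exp (-t)) atTop
      (𝓝 (b ^ Real.exp (-t) * x)) := by
  have h1 := (hb.rpow_const (p := Real.exp (-t)) (.inr (Real.exp_nonneg _))).mul (hx.comp hA)
  refine h1.congr' ?_
  filter_upwards [hA.eventually_ge_atTop 1] with n hn
  have hn' : (0 : ℝ) < A n := by exact_mod_cast hn
  have hpow : (A n : ℝ) ^ Real.exp (-t) ≠ 0 := (Real.rpow_pos_of_pos hn' _).ne'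
  rw [Function.comp_apply, scaledCount_eq, Real.div_rpow hn'.le (by positivity)]
  field_simp

/-- Limit of `IsDestruction.lintegral_profile` tested on a bounded continuous function of the scaled
counts. With `ω` fixed, the root counts in `ω'` are sampled along the subtree sizes of `ω`, whose
density is `rho u ε i 0 ω`; this yields the power factor. -/
lemma IsDestruction.lintegral_rho_eq (h : IsDestruction P u ε)
    (hu : ∀ ω, IsParentMap fun j => u j ω) (hε : ∀ ω j, 2 ≤ j → 0 < ε j ω) (hi : 1 ≤ i)
    (I : Finset ℝ≥0) (F : BoundedContinuousFunction (I → ℝ) ℝ≥0) :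
    ∫⁻ ω, F (fun k : I => rho u ε i (k : ℝ) ω) ∂P =
      ∫⁻ ω, ∫⁻ ω', F (fun k : I => rho u ε i 0 ω ^ Real.exp (-(k : ℝ)) * rho u ε 1 (k : ℝ) ω')
        ∂P ∂P := by
  set prof : ℕ → ℕ → Ω → Multiset (I → Prop) := fun i n ω =>
    profile (fun k : I => (k : ℝ)) (fun j => u j ω) (fun j => ε j ω) i n with hprof
  have hmeas : ∀ {i'} (_ : 1 ≤ i') (n m : ℕ), Measurable fun ω => scaledProfile I n (prof i' m ω) :=
    fun hi' n m => (measurable_profile hu hi' m (scaledProfile I n)).mono (h.history_le m) le_rfl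
  have hleft : Tendsto (fun n => ∫⁻ ω, F (scaledProfile I n (prof i n ω)) ∂P) atTop
      (𝓝 (∫⁻ ω, F (fun k : I => rho u ε i (k : ℝ) ω) ∂P)) :=
    tendsto_lintegral_boundedContinuous F (fun n => hmeas hi n n)
      (h.ae_tendsto_scaledProfile hu hi I)
  have hinner : ∀ᵐ ω ∂P, Tendsto (fun n => ∫⁻ ω', F (scaledProfile I n
      (prof 1 (clusterCount u ε i 0 n ω) ω')) ∂P) atTop (𝓝 (∫⁻ ω', F (fun k : I =>
        rho u ε i 0 ω ^ Real.exp (-(k : ℝ)) * rho u ε 1 (k : ℝ) ω') ∂P)) := by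
    filter_upwards [h.ae_tendsto_scaledCount hu hi le_rfl] with ω hω
    refine tendsto_lintegral_boundedContinuous F (fun n => hmeas le_rfl n _) ?_
    have hall : ∀ᵐ ω' ∂P, ∀ k : I, Tendsto (scaledCount
        (cluster (fun j => u j ω') (fun j => ε j ω') 1 (k : ℝ)) (k : ℝ)) atTop
          (𝓝 (rho u ε 1 (k : ℝ) ω')) := by
      rw [ae_all_iff]
      intro k
      filter_upwards [h.ae_tendsto_scaledCount hu le_rfl (t := ((k : ℝ≥0) : ℝ))
        (NNReal.coe_nonneg _)] with ω' hω'
      exact hω'.2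
    filter_upwards [hall] with ω' hω'
    rw [tendsto_pi_nhds]
    intro k
    simp only [hprof, scaledProfile_profile]
    refine tendsto_clusterCount_comp (tendsto_clusterCount_atTop hω.1 hω.2) ?_ (hω' k)
    refine hω.2.congr fun n => ?_
    rw [scaledCount_eq, neg_zero, Real.exp_zero, Real.rpow_one]
  have hright : Tendsto (fun n => ∫⁻ ω, ∫⁻ ω', F (scaledProfile I n
      (prof 1 (clusterCount u ε i 0 n ω) ω')) ∂P ∂P) atTop (𝓝 (∫⁻ ω, ∫⁻ ω', F (fun k : I =>
        rho u ε i 0 ω ^ Real.exp (-(k : ℝ)) * rho u ε 1 (k : ℝ) ω') ∂P ∂P)) := by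
    refine tendsto_lintegral_of_dominated_convergence (fun _ => (nndist F 0 : ENNReal))
      (fun n => ?_) (fun n => ae_of_all _ fun ω => ?_) (by simp) hinner
    · exact (Measurable.of_discrete
        (f := fun N => ∫⁻ ω', F (scaledProfile I n (prof 1 N ω')) ∂P)).comp
          ((measurable_clusterCount hu hi n).mono (h.history_le n) le_rfl)
    · refine (lintegral_mono fun ω' => (?_ : _ ≤ (nndist F 0 : ENNReal))).trans (by simp)
      exact ENNReal.coe_le_coe.2 (BoundedContinuousFunction.NNReal.upper_bound F _)
  -- The two sequences coincide as soon as `i` has been born.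
  refine tendsto_nhds_unique hleft (hright.congr' ?_)
  filter_upwards [eventually_ge_atTop i] with n hn
  have := h.lintegral_profile (τ := fun k : I => (k : ℝ)) hu hi hn
    fun M => F (scaledProfile I n M)
  simp only [card_profile_eq_clusterCount hu hε] at this
  exact this.symm

/-- The process of the weights of the clusters of `i` is distributed as a power of an independent
copy of its initial value times the process of the weights of the root cluster. -/
lemma IsDestruction.map_rho_process (h : IsDestruction P u ε)
    (hu : ∀ ω, IsParentMap fun j => u j ω) (hε : ∀ ω j, 2 ≤ j → 0 < ε j ω) (hi : 1 ≤ i) :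
    P.map (fun ω (t : ℝ≥0) => rho u ε i t ω) =
      (P.prod P).map (fun p (t : ℝ≥0) =>
        rho u ε i 0 p.1 ^ Real.exp (-(t : ℝ)) * rho u ε 1 t p.2) := by
  have hm : ∀ {i'} (_ : 1 ≤ i') (t : ℝ), Measurable (rho u ε i' t) := fun hi' =>
    h.measurable_rho hu hi'
  have hm1 : Measurable fun ω (t : ℝ≥0) => rho u ε i t ω :=
    measurable_pi_lambda _ fun t => hm hi t
  have hm2 : Measurable fun (p : Ω × Ω) (t : ℝ≥0) =>
      rho u ε i 0 p.1 ^ Real.exp (-(t : ℝ)) * rho u ε 1 t p.2 :=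
    measurable_pi_lambda _ fun t => (((hm hi 0).comp measurable_fst).pow_const _).mul
      ((hm le_rfl t).comp measurable_snd)
  have hfin : ∀ I : Finset ℝ≥0, (P.map (fun ω (t : ℝ≥0) => rho u ε i t ω)).map I.restrict =
      ((P.prod P).map (fun p (t : ℝ≥0) =>
        rho u ε i 0 p.1 ^ Real.exp (-(t : ℝ)) * rho u ε 1 t p.2)).map I.restrict := by
    intro I
    have hI : Measurable (I.restrict (π := fun _ => ℝ)) := Finset.measurable_restrict I
    rw [Measure.map_map hI hm1, Measure.map_map hI hm2]
    have : IsProbabilityMeasure (P.map (I.restrict ∘ fun ω (t : ℝ≥0) => rho u ε i t ω)) :=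
      Measure.isProbabilityMeasure_map (hI.comp hm1).aemeasurable
    refine ext_of_forall_lintegral_eq_of_IsFiniteMeasure fun F => ?_
    have hF : Measurable fun x => (F x : ENNReal) := F.continuous.measurable.coe_nnreal_ennreal
    rw [lintegral_map hF (hI.comp hm1), lintegral_map hF (hI.comp hm2)]
    exact (h.lintegral_rho_eq hu hε hi I F).trans
      (lintegral_prod _ (hF.comp (hI.comp hm2)).aemeasurable).symm
  have : IsProbabilityMeasure (P.map (fun ω (t : ℝ≥0) => rho u ε i t ω)) :=
    Measure.isProbabilityMeasure_map hm1.aemeasurable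
  have hI' : ∀ I : Finset ℝ≥0, IsFiniteMeasure
      ((P.map (fun ω (t : ℝ≥0) => rho u ε i t ω)).map I.restrict) := fun I => inferInstance
  -- Both laws are projective limits of the same finite-dimensional marginals.
  exact IsProjectiveLimit.unique
    (P := fun I => (P.map (fun ω (t : ℝ≥0) => rho u ε i t ω)).map I.restrict)
    (fun I => rfl) (fun I => (hfin I).symm)

end Law

/-! ### Transfer to the original variables and conclusion -/

lemma ae_rho_congr {Ω : Type*} [MeasurableSpace Ω] {P : Measure Ω} {u u' : ℕ → Ω → ℕ}
    {ε ε' : ℕ → Ω → ℝ} (hu' : ∀ ω, IsParentMap fun j => u' j ω)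
    (hae : ∀ᵐ ω ∂P, ∀ j, 2 ≤ j → u j ω = u' j ω ∧ ε j ω = ε' j ω) :
    ∀ᵐ ω ∂P, ∀ t : ℝ,
      (∀ i, cluster (fun j => u j ω) (fun j => ε j ω) i t =
        cluster (fun j => u' j ω) (fun j => ε' j ω) i t) ∧
      (∀ i, rho u ε i t ω = rho u' ε' i t ω) ∧
      scaledCount (rootBlock (fun j => u j ω) (fun j => ε j ω) t) t =
        scaledCount (cluster (fun j => u' j ω) (fun j => ε' j ω) 1 t) t ∧
      rootWeight u ε t ω = rho u' ε' 1 t ω := by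
  filter_upwards [hae] with ω hω t
  have h1 : ∀ i, cluster (fun j => u j ω) (fun j => ε j ω) i t =
      cluster (fun j => u' j ω) (fun j => ε' j ω) i t := fun i => cluster_congr hω
  have h2 : scaledCount (rootBlock (fun j => u j ω) (fun j => ε j ω) t) t =
      scaledCount (cluster (fun j => u' j ω) (fun j => ε' j ω) 1 t) t := by
    rw [rootBlock_congr hω, scaledCount_rootBlock (hu' ω)]
  refine ⟨h1, fun i => by rw [rho, rho, h1], h2, ?_⟩
  rw [rootWeight, rho, weight, weight, h2]

end RecursiveTree

theorem lemma1 {Ω : Type*} [MeasurableSpace Ω] (P : Measure Ω) [IsProbabilityMeasure P]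
    (u : ℕ → Ω → ℕ) (ε : ℕ → Ω → ℝ) (h : RecursiveTree.IsDestruction P u ε)
    (i : ℕ) (hi : 1 ≤ i) :
    -- almost sure existence of the limits, for the subtree of `i` and for the root block
    (∀ t : ℝ≥0, ∀ᵐ ω ∂P, 0 < RecursiveTree.rho u ε i t ω ∧
      Tendsto (RecursiveTree.scaledCount
          (RecursiveTree.cluster (fun j => u j ω) (fun j => ε j ω) i t) t)
        atTop (𝓝 (RecursiveTree.rho u ε i t ω))) ∧
    (∀ t : ℝ≥0, ∀ᵐ ω ∂P, 0 < RecursiveTree.rootWeight u ε t ω ∧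
      Tendsto (RecursiveTree.scaledCount
          (RecursiveTree.rootBlock (fun j => u j ω) (fun j => ε j ω) t) t)
        atTop (𝓝 (RecursiveTree.rootWeight u ε t ω))) ∧
    -- the law of the process: `p.1` is the beta variable, `p.2` an independent copy of the process
    -- of the weights of the root block
    IdentDistrib (fun ω (t : ℝ≥0) => RecursiveTree.rho u ε i t ω)
      (fun (p : ℝ × (ℝ≥0 → ℝ)) (t : ℝ≥0) => p.1 ^ Real.exp (-(t : ℝ)) * p.2 t)
      P ((RecursiveTree.betaLaw i).prod
        (P.map (fun ω (t : ℝ≥0) => RecursiveTree.rootWeight u ε t ω))) ∧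
    -- the moments
    (∀ (t : ℝ≥0) (q : ℝ), 0 ≤ q →
      Integrable (fun ω => RecursiveTree.rho u ε i t ω ^ q) P ∧
      ∫ ω, RecursiveTree.rho u ε i t ω ^ q ∂P =
        Real.Gamma (q + 1) * Real.Gamma i / Real.Gamma (Real.exp (-(t : ℝ)) * q + i)) := by
  obtain ⟨u', ε', h', hu', hε', hae⟩ := h.exists_regular
  have hcongr := RecursiveTree.ae_rho_congr hu' hae
  refine ⟨fun t => ?_, fun t => ?_, ?_, fun t q hq => ?_⟩
  · filter_upwards [hcongr, h'.ae_tendsto_scaledCount hu' hi t.coe_nonneg] with ω h1 h2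
    rw [(h1 t).1, (h1 t).2.1]
    exact h2
  · filter_upwards [hcongr, h'.ae_tendsto_scaledCount hu' le_rfl t.coe_nonneg] with ω h1 h2
    rw [(h1 t).2.2.1, (h1 t).2.2.2]
    exact h2
  -- The exceptional null set comes from the parents and clocks and not from `t`, so the processes
  -- agree almost surely as whole functions of `t`.
  · have hρ : (fun ω (t : ℝ≥0) => RecursiveTree.rho u ε i t ω) =ᵐ[P]
        fun ω (t : ℝ≥0) => RecursiveTree.rho u' ε' i t ω := by
      filter_upwards [hcongr] with ω hω
      exact funext fun t => (hω t).2.1 i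
    have hX : (fun ω (t : ℝ≥0) => RecursiveTree.rootWeight u ε t ω) =ᵐ[P]
        fun ω (t : ℝ≥0) => RecursiveTree.rho u' ε' 1 t ω := by
      filter_upwards [hcongr] with ω hω
      exact funext fun t => (hω t).2.2.2
    have hm : ∀ {k}, 1 ≤ k → Measurable fun ω (t : ℝ≥0) => RecursiveTree.rho u' ε' k t ω :=
      fun hk => measurable_pi_lambda _ fun t => h'.measurable_rho hu' hk t
    have hg : Measurable fun (p : ℝ × (ℝ≥0 → ℝ)) (t : ℝ≥0) =>
        p.1 ^ Real.exp (-(t : ℝ)) * p.2 t := by fun_prop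
    refine ⟨(hm hi).aemeasurable.congr hρ.symm, hg.aemeasurable, ?_⟩
    -- On `P.prod P`, the first coordinate of `ρ_i(0)` realizes the beta variable, and the second
    -- coordinate carries the independent root process.
    have hβ := h'.measurable_rho hu' hi 0
    rw [Measure.map_congr hρ, Measure.map_congr hX, ← h'.map_rho_zero hu' hi,
      Measure.map_prod_map _ _ hβ (hm le_rfl), Measure.map_map hg (hβ.prodMap (hm le_rfl)),
      h'.map_rho_process hu' hε' hi]
    rfl
  · have hae' : (fun ω => RecursiveTree.rho u ε i t ω ^ q) =ᵐ[P]
        fun ω => RecursiveTree.rho u' ε' i t ω ^ q := by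
      filter_upwards [hcongr] with ω hω
      rw [(hω t).2.1]
    rw [integrable_congr hae', integral_congr_ae hae']
    exact h'.integral_rho_rpow hu' hi t.coe_nonneg hq
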